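/- Let $r\ge 1$ be an integer and let $\mathbf m=[\mathbf m_0,\dots,\mathbf m_{r+1}]$ be a real vector with $\mathbf m_0=1$, $\mathbf m_{r+1}=0$ and $\mathbf m_k\neq 0$ for $1\le k\le r$. Let $\mathbf p=[\mathbf p_0,\dots,\mathbf p_{r+1}]$ and $\mathbf q=[\mathbf q_0,\dots,\mathbf q_{r+1}]$ satisfy $1\ge \mathbf p_0\ge \mathbf p_1\ge\dots\ge \mathbf p_r\ge \mathbf p_{r+1}=0$ and $1\ge \mathbf q_0\ge \mathbf q_1\ge\dots\ge \mathbf q_r\ge \mathbf q_{r+1}=0$. Let $x^{(1)},\dots,x^{(l)}\in\mathbb R^n$ and $y^{(1)},\dots,y^{(l)}\in\mathbb R^m$ be given, let $\beta\ge 0$, $s\in\mathbb R$ and $t\in[0,1]$. Let $G\in\mathbb R^{m\times n}$ and, for $k=1,\dots,r+1$, $u^{(4,k)}\in\mathbb R$, $u^{(2,k)}\in\mathbb R^m$, $h^{(k)}\in\mathbb R^n$ be independent with i.i.d. standard normal components, and let $\mathcal U_k=[u^{(4,k)},u^{(2,k)},h^{(k)}]$. Put $a_k=\sqrt{\mathbf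 p_{k-1}\mathbf q_{k-1}-\mathbf p_k\mathbf q_k}$, $b_k=\sqrt{\mathbf p_{k-1}-\mathbf p_k}$, $c_k=\sqrt{\mathbf q_{k-1}-\mathbf q_k}$ and $$D_0^{(i_1,i_2)}=\sqrt t\,(y^{(i_2)})^TGx^{(i_1)}+\sqrt{1-t}\,\|x^{(i_1)}\|_2(y^{(i_2)})^T\sum_{k=1}^{r+1}b_ku^{(2,k)}+\sqrt t\,\|x^{(i_1)}\|_2\|y^{(i_2)}\|_2\sum_{k=1}^{r+1}a_ku^{(4,k)}+\sqrt{1-t}\,\|y^{(i_2)}\|_2\Big(\sum_{k=1}^{r+1}c_kh^{(k)}\Big)^Tx^{(i_1)},$$ $$A^{(i_1,i_2)}=e^{\beta D_0^{(i_1,i_2)}},\qquad C^{(i_1)}=\sum_{i_2=1}^lA^{(i_1,i_2)},\qquad Z=\sum_{i_1=1}^l(C^{(i_1)})^s.$$ A subscript of $\mathbb E$ names the variables that are averaged, all others being fixed. Let $\zeta_0=Z$, $\zeta_k=\mathbb E_{\mathcal U_k}\,\zeta_{k-1}^{\mathbf m_k/\mathbf m_{k-1}}$ for $1\le k\le r$,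 and $$\psi=\psi(\mathbf p,\mathbf q)=\mathbb E_{G,\mathcal U_{r+1}}\frac{1}{\beta|s|\sqrt n\,\mathbf m_r}\log\zeta_r .$$ Let $\Phi_{\mathcal U_k}(f)=\mathbb E_{\mathcal U_k}\big(\zeta_{k-1}^{\mathbf m_k/\mathbf m_{k-1}}\zeta_k^{-1}f\big)$, $\gamma_0(i_1,i_2)=\frac{(C^{(i_1)})^s}{Z}\frac{A^{(i_1,i_2)}}{C^{(i_1)}}$, and for $k_1\in\{1,\dots,r\}$ $$\gamma^{(r)}_{k_1+1}(i_1,i_2,p_1,p_2)=\Phi_{\mathcal U_r}\cdots\Phi_{\mathcal U_{k_1+1}}\Big(\big[\Phi_{\mathcal U_{k_1}}\cdots\Phi_{\mathcal U_1}\gamma_0(i_1,i_2)\big]\cdot\big[\Phi_{\mathcal U_{k_1}}\cdots\Phi_{\mathcal U_1}\gamma_0(p_1,p_2)\big]\Big),$$ $$\langle F\rangle_{\gamma^{(r)}_{k_1+1}}=\sum_{i_1,i_2,p_1,p_2=1}^l\gamma^{(r)}_{k_1+1}(i_1,i_2,p_1,p_2)\,F(i_1,i_2,p_1,p_2).$$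 Put $$\phi^{(k_1,\mathbf p)}=-(1-t)(\mathbf m_{k_1}-\mathbf m_{k_1+1})\,\mathbb E_{G,\mathcal U_{r+1}}\big\langle\|x^{(i_1)}\|_2\|x^{(p_1)}\|_2(y^{(p_2)})^Ty^{(i_2)}\big\rangle_{\gamma^{(r)}_{k_1+1}}-t\,\mathbf q_{k_1}(\mathbf m_{k_1}-\mathbf m_{k_1+1})\,\mathbb E_{G,\mathcal U_{r+1}}\big\langle\|x^{(i_1)}\|_2\|x^{(p_1)}\|_2\|y^{(i_2)}\|_2\|y^{(p_2)}\|_2\big\rangle_{\gamma^{(r)}_{k_1+1}},$$ $$\phi^{(k_1,\mathbf q)}=-(1-t)(\mathbf m_{k_1}-\mathbf m_{k_1+1})\,\mathbb E_{G,\mathcal U_{r+1}}\big\langle\|y^{(i_2)}\|_2\|y^{(p_2)}\|_2(x^{(i_1)})^Tx^{(p_1)}\big\rangle_{\gamma^{(r)}_{k_1+1}}-t\,\mathbf p_{k_1}(\mathbf m_{k_1}-\mathbf m_{k_1+1})\,\mathbb E_{G,\mathcal U_{r+1}}\big\langle\|x^{(i_1)}\|_2\|x^{(p_1)}\|_2\|y^{(i_2)}\|_2\|y^{(p_2)}\|_2\big\rangle_{\gamma^{(r)}_{k_1+1}}.$$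 Then for every $k_1\in\{1,\dots,r\}$ the partial derivatives of $\psi$ with respect to $\mathbf p_{k_1}$ and $\mathbf q_{k_1}$ exist, where $\mathbf p_{k_1}$ varies in its admissible range $[\mathbf p_{k_1+1},\mathbf p_{k_1-1}]$ and $\mathbf q_{k_1}$ in $[\mathbf q_{k_1+1},\mathbf q_{k_1-1}]$ (at an endpoint of the range the derivative is one-sided; nothing is claimed if the range is a single point), and $$\frac{\partial\psi}{\partial\mathbf p_{k_1}}=\frac{\operatorname{sign}(s)\,s\,\beta}{2\sqrt n}\,\phi^{(k_1,\mathbf p)},\qquad \frac{\partial\psi}{\partial\mathbf q_{k_1}}=\frac{\operatorname{sign}(s)\,s\,\beta}{2\sqrt n}\,\phi^{(k_1,\mathbf q)} .$$ (In the degenerate cases $\beta=0$ or $s=0$, where the factor $1/(\beta|s|)$ is not defined, it is read as $0$.) -/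

import Mathlib

open MeasureTheory ProbabilityTheory

noncomputable section

namespace FullLift

/-- The value space of one block `U = [u⁴, u², h]`: a scalar, a vector with `m` components and a
vector with `n` components. -/
abbrev Block (m n : ℕ) : Type := ℝ × (Fin m → ℝ) × (Fin n → ℝ)

/-- The law of one block: all `1 + m + n` components are i.i.d. standard normal. -/
def blockLaw (m n : ℕ) : Measure (Block m n) :=
  (gaussianReal 0 1).prod
    ((Measure.pi fun _ : Fin m => gaussianReal 0 1).prod
      (Measure.pi fun _ : Fin n => gaussianReal 0 1))

/-- The law of the `m × n` matrix `G` with i.i.d. standard normal components. -/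
def matrixLaw (m n : ℕ) : Measure (Fin m → Fin n → ℝ) :=
  Measure.pi fun _ : Fin m => Measure.pi fun _ : Fin n => gaussianReal 0 1

/-- The expectation over the `k`-th block only: a function of the blocks `u 1, u 2, …` is averaged
over an independent Gaussian copy of `u k`, the other blocks being kept fixed. -/
def expBlock {m n : ℕ} (k : ℕ) (f : (ℕ → Block m n) → ℝ) (u : ℕ → Block m n) : ℝ :=
  ∫ v, f (Function.update u k v) ∂(blockLaw m n)

/-- The expectation over `G` and the block number `r + 1`. It is applied below to functions of `G`
and `u` that depend on `u` only through `u (r + 1)`, the blocks `u 1, …, u r` having been averaged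
out, so that the base point `0` plays no role. -/
def expOuter {m n : ℕ} (r : ℕ) (f : (Fin m → Fin n → ℝ) → (ℕ → Block m n) → ℝ) : ℝ :=
  ∫ w, f w.1 (Function.update 0 (r + 1) w.2) ∂((matrixLaw m n).prod (blockLaw m n))

/-- `a_k = √(p_{k-1} q_{k-1} - p_k q_k)`, for `k ≥ 1`. -/
def aCoef (p q : ℕ → ℝ) (k : ℕ) : ℝ := √(p (k - 1) * q (k - 1) - p k * q k)

/-- `√(p_{k-1} - p_k)`, for `k ≥ 1`: this is `b_k` for the vector `p` and `c_k` for the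
vector `q`. -/
def bCoef (p : ℕ → ℝ) (k : ℕ) : ℝ := √(p (k - 1) - p k)

section

variable {m n l : ℕ} (r : ℕ)
  (x : Fin l → EuclideanSpace ℝ (Fin n)) (y : Fin l → EuclideanSpace ℝ (Fin m))
  (p q mv : ℕ → ℝ) (β s t : ℝ) (G : Fin m → Fin n → ℝ)

/-- The exponent `D₀^{(i₁,i₂)}`. -/
def D0 (i₁ i₂ : Fin l) (u : ℕ → Block m n) : ℝ :=
  √t * (∑ j, ∑ i, y i₂ j * G j i * x i₁ i)
    + √(1 - t) * ‖x i₁‖ * (∑ j, y i₂ j * ∑ k ∈ Finset.Icc 1 (r + 1), bCoef p k * (u k).2.1 j)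
    + √t * ‖x i₁‖ * ‖y i₂‖ * (∑ k ∈ Finset.Icc 1 (r + 1), aCoef p q k * (u k).1)
    + √(1 - t) * ‖y i₂‖ * (∑ i, (∑ k ∈ Finset.Icc 1 (r + 1), bCoef q k * (u k).2.2 i) * x i₁ i)

/-- `A^{(i₁,i₂)} = exp (β D₀^{(i₁,i₂)})`. -/
def A (i₁ i₂ : Fin l) (u : ℕ → Block m n) : ℝ :=
  Real.exp (β * D0 r x y p q t G i₁ i₂ u)

/-- `C^{(i₁)} = ∑_{i₂} A^{(i₁,i₂)}`. -/
def C (i₁ : Fin l) (u : ℕ → Block m n) : ℝ := ∑ i₂, A r x y p q β t G i₁ i₂ u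

/-- `Z = ∑_{i₁} (C^{(i₁)})^s`. -/
def Z (u : ℕ → Block m n) : ℝ := ∑ i₁, C r x y p q β t G i₁ u ^ s

/-- `ζ_0 = Z` and `ζ_k = E_{U_k} ζ_{k-1}^{m_k / m_{k-1}}`. -/
def zeta : ℕ → (ℕ → Block m n) → ℝ
  | 0 => Z r x y p q β s t G
  | k + 1 => expBlock (k + 1) fun u => zeta k u ^ (mv (k + 1) / mv k)

/-- The interpolating function
`ψ = E_{G,U_{r+1}} (1 / (β |s| √n m_r)) log ζ_r`. -/
def psi : ℝ :=
  expOuter r fun (G : Fin m → Fin n → ℝ) u =>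
    1 / (β * |s| * √(n : ℝ) * mv r) * Real.log (zeta r x y p q mv β s t G r u)

/-- The operator `Φ_{U_k}`, for `k ≥ 1`: it maps `f` to
`E_{U_k} ((ζ_{k-1}^{m_k / m_{k-1}} / ζ_k) f)`. -/
def Phi (k : ℕ) (f : (ℕ → Block m n) → ℝ) : (ℕ → Block m n) → ℝ :=
  expBlock k fun u =>
    zeta r x y p q mv β s t G (k - 1) u ^ (mv k / mv (k - 1)) / zeta r x y p q mv β s t G k u * f u

/-- The composition `Φ_{U_hi} ∘ ⋯ ∘ Φ_{U_lo}` applied to `f`, with the largest index applied last;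
it is `f` itself if `hi < lo`. -/
def PhiProd (lo : ℕ) : ℕ → ((ℕ → Block m n) → ℝ) → (ℕ → Block m n) → ℝ
  | 0, f => f
  | hi + 1, f => if lo ≤ hi + 1 then Phi r x y p q mv β s t G (hi + 1) (PhiProd lo hi f) else f

/-- `γ_0(i₁,i₂) = ((C^{(i₁)})^s / Z) (A^{(i₁,i₂)} / C^{(i₁)})`. -/
def gamma0 (i₁ i₂ : Fin l) (u : ℕ → Block m n) : ℝ :=
  C r x y p q β t G i₁ u ^ s / Z r x y p q β s t G u
    * (A r x y p q β t G i₁ i₂ u / C r x y p q β t G i₁ u)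

/-- `gamma k i₁ i₂ p₁ p₂` is the weight of `(i₁,i₂,p₁,p₂)` under the measure `γ_{k+1}^{(r)}`. -/
def gamma (k : ℕ) (i₁ i₂ p₁ p₂ : Fin l) : (ℕ → Block m n) → ℝ :=
  PhiProd r x y p q mv β s t G (k + 1) r fun u =>
    PhiProd r x y p q mv β s t G 1 k (gamma0 r x y p q β s t G i₁ i₂) u
      * PhiProd r x y p q mv β s t G 1 k (gamma0 r x y p q β s t G p₁ p₂) u

/-- `E_{G,U_{r+1}} ⟨F(i₁,i₂,p₁,p₂)⟩` with the bracket taken over `γ_{k+1}^{(r)}`. -/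
def gammaAvg (k : ℕ) (F : Fin l → Fin l → Fin l → Fin l → ℝ) : ℝ :=
  expOuter r fun (G : Fin m → Fin n → ℝ) u =>
    ∑ i₁, ∑ i₂, ∑ p₁, ∑ p₂, gamma r x y p q mv β s t G k i₁ i₂ p₁ p₂ u * F i₁ i₂ p₁ p₂

/-- `φ^{(k,p)}`. -/
def phiP (k : ℕ) : ℝ :=
  -(1 - t) * (mv k - mv (k + 1))
      * gammaAvg r x y p q mv β s t k
          (fun i₁ i₂ p₁ p₂ => ‖x i₁‖ * ‖x p₁‖ * inner ℝ (y p₂) (y i₂))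
    - t * q k * (mv k - mv (k + 1))
      * gammaAvg r x y p q mv β s t k
          (fun i₁ i₂ p₁ p₂ => ‖x i₁‖ * ‖x p₁‖ * ‖y i₂‖ * ‖y p₂‖)

/-- `φ^{(k,q)}`. -/
def phiQ (k : ℕ) : ℝ :=
  -(1 - t) * (mv k - mv (k + 1))
      * gammaAvg r x y p q mv β s t k
          (fun i₁ i₂ p₁ p₂ => ‖y i₂‖ * ‖y p₂‖ * inner ℝ (x i₁) (x p₁))
    - t * p k * (mv k - mv (k + 1))
      * gammaAvg r x y p q mv β s t k
          (fun i₁ i₂ p₁ p₂ => ‖x i₁‖ * ‖x p₁‖ * ‖y i₂‖ * ‖y p₂‖)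

end

end FullLift

end

/-!
The exponent `D₀` is a Gaussian field on the finite set of index pairs `(i₁, i₂)`: a matrix part
plus one independent increment per block, the `k`-th increment being a superposition of fixed
directions `dir` with standard deviations `dev p q t k`. Hence every quantity of the theorem is a
function of the field. The levels become `V_k(x) = E V_{k-1}(x + g_k) ^ (m_k / m_{k-1})` (`lev`),
the operators `Φ` become tilted averages (`tilt`), and `zeta_eq` and `gamma_eq` translate back.

Changing `p_k` (or `q_k`) keeps the sum of the variances of the increments `k` and `k + 1` fixed,
direction by direction, and moves variance from one to the other at constant rates `κ`
(`VarianceShift`). Consider an inner Gaussian average `H`, a nonlinearity `g`, and an outer Gaussian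
average of `g ∘ H`. By Gaussian integration by parts, moving variance outwards changes `H` by
`-½ ∑ κ_j ∂_j² H` and the outer average by `½ ∑ κ_j ∂_j² (g ∘ H)`. The second derivatives of `H`
cancel, and what remains is `½ g''(H) ∑ κ_j (∂_j H)²` (`hasDerivAt_two_level`). With `g` a power, or
the logarithm if `k = r`, and with `∂ V_k = m_k β s V_k Φ_k ⋯ Φ_1 γ₀` (`exists_jet_lev`), this is the
quadratic form in the tilted weights that defines `γ_{k+1}`. The higher levels and the outer
expectations transport it by differentiation under the integral sign (`hasDerivAt_avg_log_lev`,
`hasDerivWithinAt_outer`).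

The standard deviations are square roots of the moving variances, so this computation is valid only
in the interior of the admissible range. The endpoints follow because `ψ` and the claimed derivative
are continuous up to the boundary (`hasDerivWithinAt_Icc_of_continuous`). To have functions of a
parameter in all of `ℝ`, the parameter is first projected to its range (`clamp`).

All estimates rest on one class of functions: those that grow at most exponentially, uniformly in
the parameter, and, where powers and logarithms are taken, decay at most exponentially (`Tame`,
`TamePos`). It is stable under all operations used, because Gaussian laws have exponential moments.
-/

noncomputable section

namespace GaussianHierarchy

open Real Filter Topology

/-! ### Functions of exponential growth -/

/-- A family of functions on `E`, indexed by a parameter in `P`, that is jointly continuous and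
grows at most exponentially in `x`, uniformly in the parameter. A single constant `K` bounds both
the rate and the prefactor. -/
structure Tame {P E F : Type*} [TopologicalSpace P] [NormedAddCommGroup E] [NormedAddCommGroup F]
    (f : P → E → F) : Prop where
  cont : Continuous fun q : P × E => f q.1 q.2
  bdd : ∃ K : ℝ, 0 ≤ K ∧ ∀ p x, ‖f p x‖ ≤ exp (K * (1 + ‖x‖))

/-- A tame positive family that also decays at most exponentially. -/
structure TamePos {P E : Type*} [TopologicalSpace P] [NormedAddCommGroup E]
    (f : P → E → ℝ) : Prop where
  tame : Tame f
  lower : ∃ K : ℝ, 0 ≤ K ∧ ∀ p x, exp (-(K * (1 + ‖x‖))) ≤ f p x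

section Closure

variable {P E F F₁ F₂ : Type*} [TopologicalSpace P] [NormedAddCommGroup E]
  [NormedAddCommGroup F] [NormedAddCommGroup F₁] [NormedAddCommGroup F₂]

theorem TamePos.pos {f : P → E → ℝ} (hf : TamePos f) (p : P) (x : E) : 0 < f p x := by
  obtain ⟨K, -, h⟩ := hf.lower
  exact (exp_pos _).trans_le (h p x)

theorem Tame.continuous_apply {f : P → E → F} (hf : Tame f) (p : P) : Continuous (f p) :=
  hf.cont.comp (by fun_prop : Continuous fun x : E => (p, x))

/-- A prefactor can be absorbed into the single constant of `Tame`. -/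
theorem Tame.of_bound {f : P → E → F} (hc : Continuous fun q : P × E => f q.1 q.2)
    (C K : ℝ) (hK : 0 ≤ K) (h : ∀ p x, ‖f p x‖ ≤ C * exp (K * (1 + ‖x‖))) : Tame f := by
  refine ⟨hc, |C| + K, by positivity, fun p x => (h p x).trans ?_⟩
  have hC : C ≤ exp (|C| * (1 + ‖x‖)) := by
    have h1 : |C| ≤ |C| * (1 + ‖x‖) := le_mul_of_one_le_right (abs_nonneg _) (by simp)
    have h2 := add_one_le_exp (|C| * (1 + ‖x‖))
    linarith [le_abs_self C]
  calc C * exp (K * (1 + ‖x‖)) ≤ exp (|C| * (1 + ‖x‖)) * exp (K * (1 + ‖x‖)) := by gcongr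
    _ = exp ((|C| + K) * (1 + ‖x‖)) := by rw [← exp_add]; ring_nf

theorem Tame.congr {f g : P → E → F} (hf : Tame f) (h : ∀ p x, f p x = g p x) : Tame g := by
  have : f = g := funext fun p => funext (h p)
  exact this ▸ hf

theorem Tame.const (c : F) : Tame fun (_ : P) (_ : E) => c :=
  Tame.of_bound (by fun_prop) ‖c‖ 0 le_rfl (by simp)

theorem Tame.comp_param {Q : Type*} [TopologicalSpace Q] {f : P → E → F} (hf : Tame f)
    {g : Q → P} (hg : Continuous g) : Tame fun q x => f (g q) x := by
  obtain ⟨K, hK, h⟩ := hf.bdd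
  exact ⟨hf.cont.comp (by fun_prop : Continuous fun q : Q × E => (g q.1, q.2)), K, hK,
    fun q x => h (g q) x⟩

theorem Tame.add {f g : P → E → F} (hf : Tame f) (hg : Tame g) :
    Tame fun p x => f p x + g p x := by
  obtain ⟨K, hK, h⟩ := hf.bdd
  obtain ⟨L, hL, h'⟩ := hg.bdd
  refine Tame.of_bound (hf.cont.add hg.cont) 2 (K + L) (by positivity) fun p x => ?_
  have h1 : exp (K * (1 + ‖x‖)) ≤ exp ((K + L) * (1 + ‖x‖)) := by gcongr; linarith
  have h2 : exp (L * (1 + ‖x‖)) ≤ exp ((K + L) * (1 + ‖x‖)) := by gcongr; linarith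
  linarith [norm_add_le (f p x) (g p x), h p x, h' p x]

theorem Tame.sum {ι : Type*} (s : Finset ι) {f : ι → P → E → F} (hf : ∀ i ∈ s, Tame (f i)) :
    Tame fun p x => ∑ i ∈ s, f i p x := by
  classical
  induction s using Finset.induction_on with
  | empty => simpa using Tame.const (0 : F)
  | insert i s hi ih =>
    simp only [Finset.sum_insert hi]
    exact (hf i (by simp)).add (ih fun j hj => hf j (by simp [hj]))

theorem Tame.bilin [NormedSpace ℝ F] [NormedSpace ℝ F₁] [NormedSpace ℝ F₂]
    (b : F₁ →L[ℝ] F₂ →L[ℝ] F) {f : P → E → F₁} {g : P → E → F₂} (hf : Tame f) (hg : Tame g) :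
    Tame fun p x => b (f p x) (g p x) := by
  obtain ⟨K, hK, h⟩ := hf.bdd
  obtain ⟨L, hL, h'⟩ := hg.bdd
  refine Tame.of_bound ?_ ‖b‖ (K + L) (by positivity) fun p x => ?_
  · have h1 := hf.cont
    have h2 := hg.cont
    fun_prop
  · calc ‖b (f p x) (g p x)‖ ≤ ‖b‖ * ‖f p x‖ * ‖g p x‖ := b.le_opNorm₂ _ _
      _ ≤ ‖b‖ * exp (K * (1 + ‖x‖)) * exp (L * (1 + ‖x‖)) := by
        gcongr
        · exact h p x
        · exact h' p x
      _ = ‖b‖ * exp ((K + L) * (1 + ‖x‖)) := by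
        rw [mul_assoc, ← exp_add]; ring_nf

theorem Tame.clm_comp [NormedSpace ℝ F] [NormedSpace ℝ F₁] (b : F₁ →L[ℝ] F) {f : P → E → F₁}
    (hf : Tame f) : Tame fun p x => b (f p x) := by
  obtain ⟨K, hK, h⟩ := hf.bdd
  refine Tame.of_bound (b.continuous.comp hf.cont) ‖b‖ K hK fun p x => ?_
  exact (b.le_opNorm _).trans (by gcongr; exact h p x)

theorem Tame.mul {f g : P → E → ℝ} (hf : Tame f) (hg : Tame g) :
    Tame fun p x => f p x * g p x :=
  Tame.bilin (ContinuousLinearMap.mul ℝ ℝ) hf hg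

theorem Tame.const_mul (c : ℝ) {f : P → E → ℝ} (hf : Tame f) : Tame fun p x => c * f p x :=
  (Tame.const c).mul hf

theorem Tame.smul [NormedSpace ℝ F] {f : P → E → ℝ} {g : P → E → F} (hf : Tame f)
    (hg : Tame g) : Tame fun p x => f p x • g p x :=
  Tame.bilin (ContinuousLinearMap.lsmul ℝ ℝ) hf hg

theorem Tame.smulRight [NormedSpace ℝ F] [NormedSpace ℝ F₁] {f : P → E → F₁ →L[ℝ] ℝ}
    {g : P → E → F} (hf : Tame f) (hg : Tame g) :
    Tame fun p x => (f p x).smulRight (g p x) :=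
  Tame.bilin (ContinuousLinearMap.smulRightL ℝ F₁ F) hf hg

theorem Tame.apply [NormedSpace ℝ F] [NormedSpace ℝ F₁] {f : P → E → F₁ →L[ℝ] F}
    (hf : Tame f) (w : F₁) : Tame fun p x => f p x w :=
  Tame.clm_comp (ContinuousLinearMap.apply ℝ F w) hf

theorem TamePos.abs_log_le {f : P → E → ℝ} (hf : TamePos f) :
    ∃ K : ℝ, 0 ≤ K ∧ ∀ p x, |log (f p x)| ≤ K * (1 + ‖x‖) := by
  obtain ⟨K, hK, h⟩ := hf.tame.bdd
  obtain ⟨L, hL, h'⟩ := hf.lower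
  refine ⟨K + L, by positivity, fun p x => abs_le.2 ⟨?_, ?_⟩⟩
  · rw [le_log_iff_exp_le (hf.pos p x)]
    refine le_trans ?_ (h' p x)
    gcongr; linarith
  · rw [log_le_iff_le_exp (hf.pos p x)]
    refine (le_abs_self _).trans ((h p x).trans ?_)
    gcongr; linarith

theorem TamePos.log {f : P → E → ℝ} (hf : TamePos f) : Tame fun p x => Real.log (f p x) := by
  obtain ⟨K, hK, h⟩ := hf.abs_log_le
  refine ⟨hf.tame.cont.log fun q => (hf.pos _ _).ne', K, hK, fun p x => ?_⟩
  have := add_one_le_exp (K * (1 + ‖x‖))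
  exact (h p x).trans (by linarith)

theorem TamePos.rpow {f : P → E → ℝ} (hf : TamePos f) (α : ℝ) :
    TamePos fun p x => f p x ^ α := by
  obtain ⟨K, hK, h⟩ := hf.abs_log_le
  have key : ∀ p x, |α * Real.log (f p x)| ≤ |α| * K * (1 + ‖x‖) := fun p x => by
    rw [abs_mul, mul_assoc]; gcongr; exact h p x
  refine ⟨⟨hf.tame.cont.rpow_const fun q => Or.inl (hf.pos _ _).ne', |α| * K, by positivity,
    fun p x => ?_⟩, |α| * K, by positivity, fun p x => ?_⟩
  · rw [rpow_def_of_pos (hf.pos p x), norm_of_nonneg (exp_pos _).le, mul_comm]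
    exact exp_le_exp.2 ((le_abs_self _).trans (key p x))
  · rw [rpow_def_of_pos (hf.pos p x), mul_comm (Real.log _)]
    exact exp_le_exp.2 (neg_le_of_abs_le (key p x))

theorem TamePos.inv {f : P → E → ℝ} (hf : TamePos f) : Tame fun p x => (f p x)⁻¹ := by
  have := (hf.rpow (-1)).tame
  simpa only [rpow_neg_one] using this

theorem Tame.div {f g : P → E → ℝ} (hf : Tame f) (hg : TamePos g) :
    Tame fun p x => f p x / g p x := by
  simpa only [div_eq_mul_inv] using hf.mul hg.inv

theorem TamePos.sum {ι : Type*} [Fintype ι] [Nonempty ι] {f : ι → P → E → ℝ}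
    (hf : ∀ i, TamePos (f i)) : TamePos fun p x => ∑ i, f i p x := by
  refine ⟨Tame.sum _ fun i _ => (hf i).tame, ?_⟩
  obtain ⟨i⟩ := ‹Nonempty ι›
  obtain ⟨K, hK, h⟩ := (hf i).lower
  exact ⟨K, hK, fun p x => (h p x).trans
    (Finset.single_le_sum (f := fun i => f i p x) (fun j _ => ((hf j).pos p x).le)
      (Finset.mem_univ i))⟩

theorem TamePos.exp_clm [NormedSpace ℝ E] (b : E →L[ℝ] ℝ) :
    TamePos fun (_ : P) (x : E) => exp (b x) := by
  have key : ∀ x, |b x| ≤ ‖b‖ * (1 + ‖x‖) := fun x =>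
    (b.le_opNorm x).trans (by gcongr; linarith)
  refine ⟨⟨by fun_prop, ‖b‖, by positivity, fun p x => ?_⟩, ‖b‖, by positivity, fun p x => ?_⟩
  · rw [norm_of_nonneg (exp_pos _).le]
    exact exp_le_exp.2 ((le_abs_self _).trans (key x))
  · exact exp_le_exp.2 (neg_le_of_abs_le (key x))

end Closure

/-! ### Averages over a measure with exponential moments -/

/-- All exponential moments of the norm are finite. -/
def ExpMoments {B : Type*} [NormedAddCommGroup B] [MeasurableSpace B] (μ : Measure B) : Prop :=
  ∀ K : ℝ, Integrable (fun v => exp (K * ‖v‖)) μ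

/-- A continuous family of linear maps with uniformly bounded norms. -/
structure BddCont {P F : Type*} [TopologicalSpace P] [NormedAddCommGroup F] (T : P → F) :
    Prop where
  cont : Continuous T
  bdd : ∃ R : ℝ, 0 ≤ R ∧ ∀ p, ‖T p‖ ≤ R

/-- The average of `f p` over the increment `T p v`, where `v` has law `μ`. -/
def avg {P E F B : Type*} [NormedAddCommGroup E] [NormedSpace ℝ E] [NormedAddCommGroup F]
    [NormedSpace ℝ F] [NormedAddCommGroup B] [NormedSpace ℝ B] [MeasurableSpace B]
    (μ : Measure B) (T : P → B →L[ℝ] E) (f : P → E → F) (p : P) (x : E) : F :=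
  ∫ v, f p (x + T p v) ∂μ

theorem exp_shift_le {E B : Type*} [NormedAddCommGroup E] [NormedSpace ℝ E]
    [NormedAddCommGroup B] [NormedSpace ℝ B] {K R : ℝ} (hK : 0 ≤ K) {S : B →L[ℝ] E} (hS : ‖S‖ ≤ R) (x : E) (v : B) :
    exp (K * (1 + ‖x + S v‖)) ≤ exp (K * (1 + ‖x‖)) * exp (K * R * ‖v‖) := by
  rw [← exp_add, exp_le_exp]
  have h1 : ‖x + S v‖ ≤ ‖x‖ + R * ‖v‖ :=
    (norm_add_le _ _).trans (by gcongr; exact S.le_of_opNorm_le hS v)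
  nlinarith [mul_le_mul_of_nonneg_left h1 hK]

/-- Differentiation with respect to a parameter under an integral with exponential moments. -/
theorem hasDerivAt_integral_of_exp_bound {B : Type*} [NormedAddCommGroup B]
    [MeasurableSpace B] [BorelSpace B] {μ : Measure B} (hμ : ExpMoments μ) {φ φ' : ℝ → B → ℝ} {z₀ K : ℝ}
    {s : Set ℝ} (hs : s ∈ 𝓝 z₀) (hφ : ∀ z ∈ s, Continuous (φ z)) (hφ' : Continuous (φ' z₀))
    (hb : ∀ z ∈ s, ∀ v, |φ z v| ≤ exp (K * (1 + ‖v‖)))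
    (hb' : ∀ z ∈ s, ∀ v, |φ' z v| ≤ exp (K * (1 + ‖v‖)))
    (hd : ∀ z ∈ s, ∀ v, HasDerivAt (fun ζ => φ ζ v) (φ' z v) z) :
    HasDerivAt (fun z => ∫ v, φ z v ∂μ) (∫ v, φ' z₀ v ∂μ) z₀ := by
  have hint : Integrable (fun v : B => exp (K * (1 + ‖v‖))) μ := by
    simpa only [mul_add, mul_one, exp_add] using (hμ K).const_mul (exp K)
  refine (hasDerivAt_integral_of_dominated_loc_of_deriv_le hs
    (bound := fun v => exp (K * (1 + ‖v‖)))
    (by filter_upwards [hs] with z hz using (hφ z hz).aestronglyMeasurable) ?_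
    hφ'.aestronglyMeasurable (ae_of_all _ fun v z hz => hb' z hz v) hint
    (ae_of_all _ fun v z hz => hd z hz v)).2
  exact hint.mono' (hφ z₀ (mem_of_mem_nhds hs)).aestronglyMeasurable
    (ae_of_all _ fun v => hb z₀ (mem_of_mem_nhds hs) v)

section Avg

variable {P E F B : Type*} [TopologicalSpace P] [NormedAddCommGroup E] [NormedSpace ℝ E]
  [NormedAddCommGroup F]
  [NormedAddCommGroup B] [NormedSpace ℝ B] [MeasurableSpace B] [BorelSpace B]
  [SecondCountableTopology B] {μ : Measure B} {T : P → B →L[ℝ] E}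

theorem Tame.aestronglyMeasurable_shift {f : P → E → F} (hf : Tame f) (p : P) (x : E)
    (S : B →L[ℝ] E) : AEStronglyMeasurable (fun v => f p (x + S v)) μ :=
  ((hf.continuous_apply p).comp (by fun_prop : Continuous fun v => x + S v)).aestronglyMeasurable

theorem Tame.integrable_shift (hμ : ExpMoments μ) {f : P → E → F} (hf : Tame f) (p : P) (x : E)
    (S : B →L[ℝ] E) : Integrable (fun v => f p (x + S v)) μ := by
  obtain ⟨K, hK, h⟩ := hf.bdd
  refine ((hμ (K * ‖S‖)).const_mul (exp (K * (1 + ‖x‖)))).mono'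
    (hf.aestronglyMeasurable_shift p x S) (ae_of_all _ fun v => ?_)
  exact (h p _).trans (exp_shift_le hK le_rfl x v)

/-- Averages of a tame family multiplied by the norm of the increment are finite as well. -/
theorem Tame.integrable_shift_mul (hμ : ExpMoments μ) {f : P → E → ℝ} (hf : Tame f) (p : P)
    (x : E) (S : B →L[ℝ] E) (ℓ : B →L[ℝ] ℝ) :
    Integrable (fun v => f p (x + S v) * ℓ v) μ := by
  obtain ⟨K, hK, h⟩ := hf.bdd
  refine ((hμ (K * ‖S‖ + ‖ℓ‖)).const_mul (exp (K * (1 + ‖x‖)))).mono'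
    ((hf.aestronglyMeasurable_shift p x S).mul ℓ.continuous.aestronglyMeasurable)
    (ae_of_all _ fun v => ?_)
  have h1 : ‖ℓ v‖ ≤ exp (‖ℓ‖ * ‖v‖) := by
    have := add_one_le_exp (‖ℓ‖ * ‖v‖)
    linarith [ℓ.le_opNorm v]
  calc ‖f p (x + S v) * ℓ v‖ = ‖f p (x + S v)‖ * ‖ℓ v‖ := norm_mul _ _
    _ ≤ (exp (K * (1 + ‖x‖)) * exp (K * ‖S‖ * ‖v‖)) * exp (‖ℓ‖ * ‖v‖) := by
      gcongr
      exact (h p _).trans (exp_shift_le hK le_rfl x v)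
    _ = exp (K * (1 + ‖x‖)) * exp ((K * ‖S‖ + ‖ℓ‖) * ‖v‖) := by
      rw [mul_assoc, ← exp_add]; ring_nf

variable [NormedSpace ℝ F]

theorem Tame.avg [FirstCountableTopology P] (hμ : ExpMoments μ) (hT : BddCont T) {f : P → E → F} (hf : Tame f) :
    Tame (avg μ T f) := by
  obtain ⟨K, hK, h⟩ := hf.bdd
  obtain ⟨R, hR, hTR⟩ := hT.bdd
  refine Tame.of_bound ?_ (∫ v, exp (K * R * ‖v‖) ∂μ) K hK fun p x => ?_
  · refine continuous_iff_continuousAt.2 fun q₀ => ?_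
    refine continuousAt_of_dominated
      (bound := fun v => exp (K * (1 + (‖q₀.2‖ + 1))) * exp (K * R * ‖v‖))
      (Eventually.of_forall fun q => hf.aestronglyMeasurable_shift _ _ _) ?_
      ((hμ _).const_mul _) (ae_of_all _ fun v => ?_)
    · have : ∀ᶠ q : P × E in 𝓝 q₀, ‖q.2‖ < ‖q₀.2‖ + 1 :=
        (by fun_prop : Continuous fun q : P × E => ‖q.2‖).continuousAt.eventually_lt
          continuousAt_const (by simp)
      filter_upwards [this] with q hq
      refine ae_of_all _ fun v => (h _ _).trans ((exp_shift_le hK (hTR _) _ _).trans ?_)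
      gcongr
    · have h1 := hT.cont
      have h2 : Continuous fun q : P × E => (q.1, q.2 + T q.1 v) := by fun_prop
      exact (hf.cont.comp h2).continuousAt
  · refine (norm_integral_le_of_norm_le ((hμ (K * R)).const_mul (exp (K * (1 + ‖x‖))))
      (ae_of_all _ fun v => (h p _).trans (exp_shift_le hK (hTR _) x v))).trans_eq ?_
    rw [integral_const_mul, mul_comm]

theorem TamePos.avg [FirstCountableTopology P] [IsProbabilityMeasure μ] (hμ : ExpMoments μ) (hT : BddCont T)
    {f : P → E → ℝ} (hf : TamePos f) : TamePos (avg μ T f) := by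
  refine ⟨hf.tame.avg hμ hT, ?_⟩
  obtain ⟨K, hK, h⟩ := hf.lower
  obtain ⟨R, hR, hTR⟩ := hT.bdd
  set c := ∫ v, exp (-(K * R) * ‖v‖) ∂μ with hc
  have hc0 : 0 < c := integral_exp_pos (hμ _)
  have hlow : ∀ p x, c * exp (-(K * (1 + ‖x‖))) ≤ GaussianHierarchy.avg μ T f p x := fun p x => by
    rw [hc, mul_comm, ← integral_const_mul]
    refine integral_mono ((hμ _).const_mul _) (hf.tame.integrable_shift hμ _ _ _) fun v => ?_
    refine le_trans ?_ (h p _)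
    have := exp_shift_le hK (hTR p) x v
    rw [← exp_add] at this ⊢
    rw [exp_le_exp] at this ⊢
    linarith
  refine ⟨K + |Real.log c|, by positivity, fun p x => le_trans ?_ (hlow p x)⟩
  conv_rhs => rw [← exp_log hc0]
  rw [← exp_add, exp_le_exp]
  nlinarith [neg_abs_le (Real.log c), mul_nonneg (abs_nonneg (Real.log c)) (norm_nonneg x)]

/-- Differentiation in `x` under the average. -/
theorem hasFDerivAt_avg (hμ : ExpMoments μ) {f : P → E → F} {f' : P → E → E →L[ℝ] F}
    (hf : Tame f) (hf' : Tame f') (hd : ∀ p x, HasFDerivAt (f p) (f' p x) x) (p : P) (x : E) :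
    HasFDerivAt (avg μ T f p) (avg μ T f' p x) x := by
  obtain ⟨K, hK, h⟩ := hf'.bdd
  refine hasFDerivAt_integral_of_dominated_of_fderiv_le (Metric.ball_mem_nhds x one_pos)
    (F := fun y v => f p (y + T p v)) (F' := fun y v => f' p (y + T p v))
    (bound := fun v => exp (K * (1 + (‖x‖ + 1))) * exp (K * ‖T p‖ * ‖v‖))
    (Eventually.of_forall fun y => hf.aestronglyMeasurable_shift _ _ _)
    (hf.integrable_shift hμ _ _ _) (hf'.aestronglyMeasurable_shift _ _ _)
    (ae_of_all _ fun v y hy => ?_) ((hμ _).const_mul _) (ae_of_all _ fun v y _ => ?_)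
  · refine (h _ _).trans ((exp_shift_le hK le_rfl _ _).trans ?_)
    have : ‖y‖ ≤ ‖x‖ + 1 := by
      have := norm_sub_norm_le y x
      rw [mem_ball_iff_norm] at hy
      linarith
    gcongr
  · simpa [Function.comp_def] using
      (hd p (y + T p v)).comp y ((hasFDerivAt_id y).add_const (T p v))

end Avg

/-! ### Gaussian laws: exponential moments and integration by parts -/

/-- Gaussian integration by parts for the linear functional `ℓ`: the factor `ℓ v` may be traded
for the derivative in the direction `h`. -/
def SteinPair {B : Type*} [NormedAddCommGroup B] [NormedSpace ℝ B] [MeasurableSpace B]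
    (μ : Measure B) (ℓ : B →L[ℝ] ℝ) (h : B) : Prop :=
  ∀ φ φ' : B → ℝ, Continuous φ → Continuous φ' →
    (∃ K : ℝ, 0 ≤ K ∧ ∀ v, |φ v| ≤ exp (K * (1 + ‖v‖)) ∧ |φ' v| ≤ exp (K * (1 + ‖v‖))) →
    (∀ v, HasDerivAt (fun s : ℝ => φ (v + s • h)) (φ' v) 0) →
    ∫ v, φ v * ℓ v ∂μ = ∫ v, φ' v ∂μ

section ExpMoments

variable {B B' : Type*} [NormedAddCommGroup B] [MeasurableSpace B] [NormedAddCommGroup B']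
  [MeasurableSpace B']

theorem expMoments_gaussianReal : ExpMoments (gaussianReal 0 1) := by
  intro K
  refine ((integrable_exp_mul_gaussianReal K).add (integrable_exp_mul_gaussianReal (-K))).mono'
    (by fun_prop) (ae_of_all _ fun x => ?_)
  rw [norm_of_nonneg (exp_pos _).le, Real.norm_eq_abs]
  rcases abs_cases x with ⟨h, -⟩ | ⟨h, -⟩ <;> rw [h]
  · simp only [Pi.add_apply]; linarith [exp_pos (-K * x)]
  · simp only [Pi.add_apply]
    rw [mul_neg, ← neg_mul]; linarith [exp_pos (K * x)]

theorem ExpMoments.of_nonneg [OpensMeasurableSpace B] {μ : Measure B}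
    (h : ∀ K : ℝ, 0 ≤ K → Integrable (fun v => exp (K * ‖v‖)) μ) : ExpMoments μ := by
  intro K
  refine (h |K| (abs_nonneg K)).mono' (by fun_prop) (ae_of_all _ fun v => ?_)
  rw [norm_of_nonneg (exp_pos _).le]
  gcongr
  exact le_abs_self K

theorem ExpMoments.prod [BorelSpace B] [BorelSpace B'] [SecondCountableTopology B]
    {μ : Measure B} {ν : Measure B'} [SFinite μ] [SFinite ν] (hμ : ExpMoments μ)
    (hν : ExpMoments ν) : ExpMoments (μ.prod ν) := by
  have : OpensMeasurableSpace (B × B') := by infer_instance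
  refine ExpMoments.of_nonneg fun K hK => ?_
  refine ((hμ K).mul_prod (hν K)).mono' (by fun_prop) (ae_of_all _ fun v => ?_)
  rw [norm_of_nonneg (exp_pos _).le, ← exp_add, ← mul_add]
  gcongr
  rw [Prod.norm_def]
  exact max_le_add_of_nonneg (norm_nonneg _) (norm_nonneg _)

theorem ExpMoments.pi [BorelSpace B] [SecondCountableTopology B] {ι : Type*} [Fintype ι]
    {μ : Measure B} [SigmaFinite μ] (hμ : ExpMoments μ) :
    ExpMoments (Measure.pi fun _ : ι => μ) := by
  refine ExpMoments.of_nonneg fun K hK => ?_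
  refine (Integrable.fintype_prod (f := fun (_ : ι) (v : B) => exp (K * ‖v‖))
    (fun _ => hμ K)).mono' (by fun_prop) (ae_of_all _ fun v => ?_)
  rw [norm_of_nonneg (exp_pos _).le, ← exp_sum, ← Finset.mul_sum]
  gcongr
  exact (pi_norm_le_iff_of_nonneg (Finset.sum_nonneg fun _ _ => norm_nonneg _)).2 fun i =>
    Finset.single_le_sum (f := fun i => ‖v i‖) (fun _ _ => norm_nonneg _) (Finset.mem_univ i)

end ExpMoments

section Stein

theorem integrable_exp_growth {B : Type*} [NormedAddCommGroup B] [MeasurableSpace B]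
    [BorelSpace B] {μ : Measure B} (hμ : ExpMoments μ) {φ : B → ℝ} (hφ : Continuous φ) {K : ℝ}
    (h : ∀ v, |φ v| ≤ exp (K * (1 + ‖v‖))) : Integrable φ μ := by
  have hint : Integrable (fun v : B => exp (K * (1 + ‖v‖))) μ := by
    simpa only [mul_add, mul_one, exp_add] using (hμ K).const_mul (exp K)
  exact hint.mono' hφ.aestronglyMeasurable (ae_of_all _ h)

theorem integrable_exp_growth_mul {B : Type*} [NormedAddCommGroup B] [NormedSpace ℝ B]
    [MeasurableSpace B] [BorelSpace B] {μ : Measure B} (hμ : ExpMoments μ) {φ : B → ℝ}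
    (hφ : Continuous φ) {K : ℝ} (h : ∀ v, |φ v| ≤ exp (K * (1 + ‖v‖))) (ℓ : B →L[ℝ] ℝ) :
    Integrable (fun v => φ v * ℓ v) μ := by
  refine integrable_exp_growth hμ (K := K + ‖ℓ‖) (by fun_prop) fun v => ?_
  have h1 : |ℓ v| ≤ exp (‖ℓ‖ * (1 + ‖v‖)) := by
    have := add_one_le_exp (‖ℓ‖ * (1 + ‖v‖))
    have h2 : |ℓ v| ≤ ‖ℓ‖ * ‖v‖ := ℓ.le_opNorm v
    nlinarith [norm_nonneg ℓ]
  rw [abs_mul, add_mul, exp_add]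
  gcongr
  exact h v

theorem hasDerivAt_gaussianPDFReal (x : ℝ) :
    HasDerivAt (gaussianPDFReal 0 1) (-x * gaussianPDFReal 0 1 x) x := by
  have h : gaussianPDFReal 0 1 = fun x => (√(2 * π))⁻¹ * exp (-x ^ 2 / 2) := by
    ext x; simp [gaussianPDFReal]
  rw [h]
  have h1 : HasDerivAt (fun x : ℝ => -x ^ 2 / 2) (-x) x := by
    have := ((hasDerivAt_pow 2 x).neg).div_const 2
    refine this.congr_deriv ?_
    norm_num
    ring
  refine (h1.exp.const_mul _).congr_deriv ?_
  ring

theorem steinPair_gaussianReal :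
    SteinPair (gaussianReal 0 1) (ContinuousLinearMap.id ℝ ℝ) 1 := by
  rintro φ φ' hφ hφ' ⟨K, hK, hb⟩ hd
  have hd' : ∀ x, HasDerivAt φ (φ' x) x := fun x => by
    have h1 : HasDerivAt (fun s : ℝ => φ (x + s)) (φ' x) 0 := by simpa using hd x
    have h2 : HasDerivAt (fun s : ℝ => φ (x + s)) (φ' x) (x - x) := by simpa using h1
    have h3 := h2.comp_sub_const x x
    simpa using h3
  have hint : ∀ f : ℝ → ℝ, Integrable f (gaussianReal 0 1) →
      Integrable fun x => f x * gaussianPDFReal 0 1 x := fun f hf => by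
    rw [gaussianReal_of_var_ne_zero _ one_ne_zero,
      integrable_withDensity_iff (measurable_gaussianPDF 0 1)
        (ae_of_all _ fun _ => gaussianPDF_lt_top)] at hf
    simpa only [toReal_gaussianPDF] using hf
  have h1 := hint _ (integrable_exp_growth expMoments_gaussianReal hφ fun v => (hb v).1)
  have h2 := hint _ (integrable_exp_growth expMoments_gaussianReal hφ' fun v => (hb v).2)
  have h3 := hint _ (integrable_exp_growth_mul expMoments_gaussianReal hφ (fun v => (hb v).1)
    (ContinuousLinearMap.id ℝ ℝ))
  have key := integral_mul_deriv_eq_deriv_mul_of_integrable (u := φ) (u' := φ')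
    (v := gaussianPDFReal 0 1) (v' := fun x => -x * gaussianPDFReal 0 1 x)
    (fun x _ => hd' x) (fun x _ => hasDerivAt_gaussianPDFReal x)
    (by refine h3.neg.congr (ae_of_all _ fun x => ?_); simp; ring) h2 h1
  rw [integral_gaussianReal_eq_integral_smul one_ne_zero,
    integral_gaussianReal_eq_integral_smul one_ne_zero]
  simp only [smul_eq_mul, ContinuousLinearMap.id_apply]
  have e1 : ∀ x, φ x * (-x * gaussianPDFReal 0 1 x) = -(gaussianPDFReal 0 1 x * (φ x * x)) :=
    fun x => by ring
  simp only [e1, integral_neg, neg_inj] at key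
  rw [key]
  exact integral_congr_ae (ae_of_all _ fun x => mul_comm _ _)

/-- Transport along a measure-preserving homeomorphism given by a linear map `e`. -/
theorem SteinPair.map {B B' : Type*} [NormedAddCommGroup B] [NormedSpace ℝ B] [MeasurableSpace B]
    [NormedAddCommGroup B'] [NormedSpace ℝ B'] [MeasurableSpace B'] {μ : Measure B}
    {ℓ : B →L[ℝ] ℝ} {h : B} {ν : Measure B'} (hs : SteinPair μ ℓ h)
    (e : B →L[ℝ] B') (he : MeasurableEmbedding e) (hmp : MeasurePreserving e μ ν)
    {ℓ' : B' →L[ℝ] ℝ} (hℓ : ∀ v, ℓ' (e v) = ℓ v) : SteinPair ν ℓ' (e h) := by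
  rintro φ φ' hφ hφ' ⟨K, hK, hb⟩ hd
  rw [← hmp.integral_comp he, ← hmp.integral_comp he]
  simp only [hℓ]
  refine hs (fun v => φ (e v)) (fun v => φ' (e v)) (by fun_prop) (by fun_prop)
    ⟨K * (1 + ‖e‖), by positivity, fun v => ?_⟩ fun v => by simpa using hd (e v)
  have h1 : exp (K * (1 + ‖e v‖)) ≤ exp (K * (1 + ‖e‖) * (1 + ‖v‖)) := by
    rw [exp_le_exp, mul_assoc]
    gcongr
    nlinarith [e.le_opNorm v, norm_nonneg e, norm_nonneg v]
  exact ⟨(hb _).1.trans h1, (hb _).2.trans h1⟩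

variable {B B' : Type*} [NormedAddCommGroup B] [NormedSpace ℝ B] [MeasurableSpace B]
  [NormedAddCommGroup B'] [NormedSpace ℝ B'] [MeasurableSpace B'] [BorelSpace B] [BorelSpace B']
  [SecondCountableTopology B] {μ : Measure B} {ν : Measure B'} [SFinite μ] [SFinite ν]

theorem SteinPair.prod_left (hμ : ExpMoments μ) (hν : ExpMoments ν) {ℓ : B →L[ℝ] ℝ} {h : B}
    (hs : SteinPair μ ℓ h) :
    SteinPair (μ.prod ν) (ℓ.comp (ContinuousLinearMap.fst ℝ B B')) (h, 0) := by
  rintro φ φ' hφ hφ' ⟨K, hK, hb⟩ hd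
  have hμν := hμ.prod hν
  rw [integral_prod_symm _ (integrable_exp_growth_mul hμν hφ (fun v => (hb v).1) _),
    integral_prod_symm _ (integrable_exp_growth hμν hφ' fun v => (hb v).2)]
  congr 1 with w
  refine hs (fun v => φ (v, w)) (fun v => φ' (v, w)) (by fun_prop) (by fun_prop)
    ⟨K * (1 + ‖w‖), by positivity, fun v => ?_⟩ fun v => by simpa using hd (v, w)
  have h1 : exp (K * (1 + ‖(v, w)‖)) ≤ exp (K * (1 + ‖w‖) * (1 + ‖v‖)) := by
    rw [exp_le_exp, mul_assoc]
    gcongr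
    have : ‖(v, w)‖ ≤ ‖v‖ + ‖w‖ := by
      rw [Prod.norm_def]
      exact max_le_add_of_nonneg (norm_nonneg _) (norm_nonneg _)
    nlinarith [mul_nonneg (norm_nonneg v) (norm_nonneg w)]
  exact ⟨(hb _).1.trans h1, (hb _).2.trans h1⟩

theorem SteinPair.prod_right (hμ : ExpMoments μ) (hν : ExpMoments ν) {ℓ : B' →L[ℝ] ℝ} {h : B'}
    (hs : SteinPair ν ℓ h) :
    SteinPair (μ.prod ν) (ℓ.comp (ContinuousLinearMap.snd ℝ B B')) (0, h) := by
  rintro φ φ' hφ hφ' ⟨K, hK, hb⟩ hd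
  have hμν := hμ.prod hν
  rw [integral_prod _ (integrable_exp_growth_mul hμν hφ (fun v => (hb v).1) _),
    integral_prod _ (integrable_exp_growth hμν hφ' fun v => (hb v).2)]
  congr 1 with w
  refine hs (fun v => φ (w, v)) (fun v => φ' (w, v)) (by fun_prop) (by fun_prop)
    ⟨K * (1 + ‖w‖), by positivity, fun v => ?_⟩ fun v => by simpa using hd (w, v)
  have h1 : exp (K * (1 + ‖(w, v)‖)) ≤ exp (K * (1 + ‖w‖) * (1 + ‖v‖)) := by
    rw [exp_le_exp, mul_assoc]
    gcongr
    have : ‖(w, v)‖ ≤ ‖w‖ + ‖v‖ := by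
      rw [Prod.norm_def]
      exact max_le_add_of_nonneg (norm_nonneg _) (norm_nonneg _)
    nlinarith [mul_nonneg (norm_nonneg v) (norm_nonneg w)]
  exact ⟨(hb _).1.trans h1, (hb _).2.trans h1⟩

theorem steinPair_pi_gaussianReal {m : ℕ} (j : Fin m) :
    SteinPair (Measure.pi fun _ : Fin m => gaussianReal 0 1)
      (ContinuousLinearMap.proj (R := ℝ) (φ := fun _ : Fin m => ℝ) j) (Pi.single j 1) := by
  obtain ⟨m, rfl⟩ : ∃ k, m = k + 1 := ⟨m - 1, by have := j.pos; omega⟩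
  have hmp := (measurePreserving_piFinSuccAbove (fun _ : Fin (m + 1) => gaussianReal 0 1) j).symm
  let e : (ℝ × (Fin m → ℝ)) →L[ℝ] (Fin (m + 1) → ℝ) :=
    LinearMap.toContinuousLinearMap
      { toFun := fun v => j.insertNth (α := fun _ => ℝ) v.1 v.2
        map_add' := fun v w => by
          ext i
          refine Fin.succAboveCases j ?_ (fun i => ?_) i <;> simp
        map_smul' := fun c v => by
          ext i
          refine Fin.succAboveCases j ?_ (fun i => ?_) i <;> simp }
  have he : ∀ v, e v = j.insertNth (α := fun _ => ℝ) v.1 v.2 := fun v => rfl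
  have hfun : (e : ℝ × (Fin m → ℝ) → Fin (m + 1) → ℝ)
      = (MeasurableEquiv.piFinSuccAbove (fun _ : Fin (m + 1) => ℝ) j).symm := by
    ext v i; rfl
  have hs := (steinPair_gaussianReal.prod_left (ν := Measure.pi fun _ : Fin m => gaussianReal 0 1)
    expMoments_gaussianReal expMoments_gaussianReal.pi)
  have h1 : e ((1 : ℝ), 0) = Pi.single j 1 := by
    ext i
    rw [he]
    refine Fin.succAboveCases j ?_ (fun i => ?_) i <;> simp
  rw [← h1]
  refine hs.map e ?_ ?_ fun v => ?_
  · rw [hfun]; exact MeasurableEquiv.measurableEmbedding _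
  · rw [hfun]; exact hmp
  · simp [he]

end Stein

/-! ### Twice differentiable tame families -/

/-- A tame family of real functions with tame first and second derivatives in `x`. -/
structure Jet {P E : Type*} [TopologicalSpace P] [NormedAddCommGroup E] [NormedSpace ℝ E]
    (f : P → E → ℝ) (f' : P → E → E →L[ℝ] ℝ) (f'' : P → E → E →L[ℝ] E →L[ℝ] ℝ) : Prop where
  tame : Tame f
  tame' : Tame f'
  tame'' : Tame f''
  hasFDerivAt : ∀ p x, HasFDerivAt (f p) (f' p x) x
  hasFDerivAt' : ∀ p x, HasFDerivAt (f' p) (f'' p x) x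

section Jet

variable {P E : Type*} [TopologicalSpace P] [NormedAddCommGroup E] [NormedSpace ℝ E]

theorem Jet.exp_clm (b : E →L[ℝ] ℝ) :
    Jet (fun (_ : P) x => exp (b x)) (fun _ x => exp (b x) • b)
      (fun _ x => (exp (b x) • b).smulRight b) := by
  have h := (TamePos.exp_clm (P := P) b).tame
  have h' := h.smul (Tame.const b)
  exact ⟨h, h', h'.smulRight (Tame.const b), fun _ x => b.hasFDerivAt.exp,
    fun _ x => (b.hasFDerivAt.exp).smul_const b⟩

theorem Jet.sum {ι : Type*} [Fintype ι] {f : ι → P → E → ℝ} {f' : ι → P → E → E →L[ℝ] ℝ}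
    {f'' : ι → P → E → E →L[ℝ] E →L[ℝ] ℝ} (h : ∀ i, Jet (f i) (f' i) (f'' i)) :
    Jet (fun p x => ∑ i, f i p x) (fun p x => ∑ i, f' i p x) (fun p x => ∑ i, f'' i p x) :=
  ⟨Tame.sum _ fun i _ => (h i).tame, Tame.sum _ fun i _ => (h i).tame',
    Tame.sum _ fun i _ => (h i).tame'',
    fun p x => HasFDerivAt.fun_sum fun i _ => (h i).hasFDerivAt p x,
    fun p x => HasFDerivAt.fun_sum fun i _ => (h i).hasFDerivAt' p x⟩

/-- Composition with a function `g` whose derivative is `c y ^ (α - 1)`: a power, or the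
logarithm (`c = 1`, `α = 0`). -/
theorem Jet.comp {f : P → E → ℝ} {f' : P → E → E →L[ℝ] ℝ} {f'' : P → E → E →L[ℝ] E →L[ℝ] ℝ}
    (hf : Jet f f' f'') (hpos : TamePos f) {g : ℝ → ℝ} {c α : ℝ}
    (hg : ∀ y, 0 < y → HasDerivAt g (c * y ^ (α - 1)) y) (hgf : Tame fun p x => g (f p x)) :
    Jet (fun p x => g (f p x)) (fun p x => (c * f p x ^ (α - 1)) • f' p x)
      (fun p x => (c * f p x ^ (α - 1)) • f'' p x
        + ((c * (α - 1) * f p x ^ (α - 2)) • f' p x).smulRight (f' p x)) := by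
  have h1 := (hpos.rpow (α - 1)).tame.const_mul c
  have h2 := (hpos.rpow (α - 2)).tame.const_mul (c * (α - 1))
  refine ⟨hgf, h1.smul hf.tame', (h1.smul hf.tame'').add ((h2.smul hf.tame').smulRight hf.tame'),
    fun p x => (hg _ (hpos.pos p x)).comp_hasFDerivAt x (hf.hasFDerivAt p x), fun p x => ?_⟩
  have h3 : HasFDerivAt (fun x => c * f p x ^ (α - 1))
      ((c * (α - 1) * f p x ^ (α - 2)) • f' p x) x := by
    have h4 : HasDerivAt (fun y : ℝ => c * y ^ (α - 1)) (c * (α - 1) * f p x ^ (α - 2)) (f p x) := by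
      refine ((Real.hasDerivAt_rpow_const (p := α - 1)
        (Or.inl (hpos.pos p x).ne')).const_mul c).congr_deriv ?_
      rw [show α - 1 - 1 = α - 2 by ring]; ring
    exact h4.comp_hasFDerivAt x (hf.hasFDerivAt p x)
  exact h3.smul (hf.hasFDerivAt' p x)

theorem Jet.avg {B : Type*} [FirstCountableTopology P] [NormedAddCommGroup B] [NormedSpace ℝ B]
    [MeasurableSpace B] [BorelSpace B] [SecondCountableTopology B] {μ : Measure B}
    {T : P → B →L[ℝ] E} (hμ : ExpMoments μ) (hT : BddCont T) {f : P → E → ℝ}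
    {f' : P → E → E →L[ℝ] ℝ} {f'' : P → E → E →L[ℝ] E →L[ℝ] ℝ} (hf : Jet f f' f'') :
    Jet (avg μ T f) (avg μ T f') (avg μ T f'') :=
  ⟨hf.tame.avg hμ hT, hf.tame'.avg hμ hT, hf.tame''.avg hμ hT,
    hasFDerivAt_avg hμ hf.tame hf.tame' hf.hasFDerivAt,
    hasFDerivAt_avg hμ hf.tame' hf.tame'' hf.hasFDerivAt'⟩

end Jet

/-! ### Moving variance between two consecutive Gaussian levels -/

section Incr

variable {E B J : Type*} [NormedAddCommGroup E] [NormedSpace ℝ E] [NormedAddCommGroup B]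
  [NormedSpace ℝ B] [Fintype J]

/-- The Gaussian increment `∑ j, τ j • ℓ j v • w j`: a superposition of the fixed directions `w j`
with independent standard normal coefficients `ℓ j v` and standard deviations `τ j`. -/
def incr (ℓ : J → B →L[ℝ] ℝ) (w : J → E) (τ : J → ℝ) : B →L[ℝ] E :=
  ∑ j, τ j • (ℓ j).smulRight (w j)

theorem incr_apply (ℓ : J → B →L[ℝ] ℝ) (w : J → E) (τ : J → ℝ) (v : B) :
    incr ℓ w τ v = ∑ j, (τ j * ℓ j v) • w j := by
  simp [incr, mul_smul]

theorem bddCont_incr {P : Type*} [TopologicalSpace P] (ℓ : J → B →L[ℝ] ℝ) (w : J → E)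
    {τ : P → J → ℝ} (hc : ∀ j, Continuous fun p => τ p j) (hb : ∀ j, ∃ R, ∀ p, |τ p j| ≤ R) :
    BddCont fun p => incr ℓ w (τ p) := by
  choose R hR using hb
  refine ⟨by unfold incr; fun_prop, ∑ j, |R j| * ‖(ℓ j).smulRight (w j)‖, by positivity,
    fun p => (norm_sum_le _ _).trans (Finset.sum_le_sum fun j _ => ?_)⟩
  rw [norm_smul]
  gcongr
  exact (hR j p).trans (le_abs_self _)

theorem hasDerivAt_incr (ℓ : J → B →L[ℝ] ℝ) (w : J → E) {τ : ℝ → J → ℝ} {σ : J → ℝ} {z : ℝ}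
    (h : ∀ j, HasDerivAt (fun z => τ z j) (σ j) z) (v : B) :
    HasDerivAt (fun z => incr ℓ w (τ z) v) (incr ℓ w σ v) z := by
  simp only [incr_apply]
  exact HasDerivAt.fun_sum fun j _ => ((h j).mul_const _).smul_const _

end Incr

/-- Coordinate functionals `ℓ j` with dual directions `h j`, each admitting Gaussian integration by
parts. -/
structure GaussianFrame {B J : Type*} [DecidableEq J] [NormedAddCommGroup B] [NormedSpace ℝ B]
    [MeasurableSpace B] (μ : Measure B) (ℓ : J → B →L[ℝ] ℝ) (h : J → B) : Prop where
  stein : ∀ j, SteinPair μ (ℓ j) (h j)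
  dual : ∀ i j, ℓ i (h j) = if i = j then 1 else 0

section TwoLevel

variable {E B J : Type*} [NormedAddCommGroup E] [NormedSpace ℝ E] [NormedAddCommGroup B]
  [NormedSpace ℝ B] [MeasurableSpace B] [BorelSpace B] [SecondCountableTopology B]
  [Fintype J] [DecidableEq J] {μ : Measure B} {ℓ : J → B →L[ℝ] ℝ} {h : J → B}

/-- One constant serves all parameters, bounded base points `x` and bounded increment maps `S`. -/
theorem Tame.exp_growth_shift {P F : Type*} [TopologicalSpace P] [NormedAddCommGroup F]
    {E B : Type*} [NormedAddCommGroup E] [NormedSpace ℝ E] [NormedAddCommGroup B]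
    [NormedSpace ℝ B] {f : P → E → F} (hf : Tame f) (a R : ℝ) :
    ∃ K : ℝ, 0 ≤ K ∧ ∀ p (x : E) (S : B →L[ℝ] E) v, ‖x‖ ≤ a → ‖S‖ ≤ R →
      ‖f p (x + S v)‖ ≤ exp (K * (1 + ‖v‖)) := by
  obtain ⟨K, hK, hb⟩ := hf.bdd
  refine ⟨K * (1 + |a|) + K * |R|, by positivity, fun p x S v hx hS => (hb _ _).trans ?_⟩
  refine (exp_shift_le hK (hS.trans (le_abs_self R)) x v).trans ?_
  rw [← exp_add, exp_le_exp]
  have h1 : K * (1 + ‖x‖) ≤ K * (1 + |a|) := by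
    gcongr; exact hx.trans (le_abs_self a)
  have h2 : 0 ≤ K * (1 + |a|) * ‖v‖ := by positivity
  have h3 : 0 ≤ K * |R| := by positivity
  nlinarith

/-- Gaussian integration by parts for the increment `incr ℓ w τ v`. -/
theorem integral_fderiv_incr (hμ : ExpMoments μ) (hfr : GaussianFrame μ ℓ h) (w : J → E)
    {P : Type*} [TopologicalSpace P] {f : P → E → ℝ} {f' : P → E → E →L[ℝ] ℝ}
    {f'' : P → E → E →L[ℝ] E →L[ℝ] ℝ} (hf : Jet f f' f'') (p : P) (x : E) (τ σ : J → ℝ) :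
    ∫ v, f' p (x + incr ℓ w τ v) (incr ℓ w σ v) ∂μ
      = ∑ j, σ j * τ j * ∫ v, f'' p (x + incr ℓ w τ v) (w j) (w j) ∂μ := by
  have h1 : ∀ v, f' p (x + incr ℓ w τ v) (incr ℓ w σ v)
      = ∑ j, σ j * (f' p (x + incr ℓ w τ v) (w j) * ℓ j v) := fun v => by
    rw [incr_apply ℓ w σ, map_sum]
    refine Finset.sum_congr rfl fun j _ => ?_
    rw [map_smul, smul_eq_mul]; ring
  simp only [h1]
  rw [integral_finsetSum _ fun j _ =>
    ((hf.tame'.apply (w j)).integrable_shift_mul hμ p x _ (ℓ j)).const_mul _]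
  refine Finset.sum_congr rfl fun j _ => ?_
  rw [integral_const_mul, mul_assoc, ← integral_const_mul (τ j)]
  congr 1
  have hw : incr ℓ w τ (h j) = τ j • w j := by
    rw [incr_apply, Finset.sum_eq_single j]
    · simp [hfr.dual]
    · intro i _ hij; simp [hfr.dual, hij]
    · simp
  obtain ⟨K, hK, hb⟩ := (hf.tame'.apply (w j)).exp_growth_shift (B := B) ‖x‖ ‖incr ℓ w τ‖
  obtain ⟨L, hL, hb'⟩ := (((hf.tame''.apply (w j)).apply (w j)).const_mul
    (τ j)).exp_growth_shift (B := B) ‖x‖ ‖incr ℓ w τ‖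
  refine hfr.stein j _ _ ?_ ?_ ⟨K + L, by positivity, fun v => ⟨?_, ?_⟩⟩ fun v => ?_
  · exact ((hf.tame'.apply (w j)).continuous_apply p).comp (by fun_prop)
  · exact ((((hf.tame''.apply (w j)).apply (w j)).const_mul (τ j)).continuous_apply p).comp
      (by fun_prop)
  · refine (hb p x _ v le_rfl le_rfl).trans ?_
    gcongr; linarith
  · refine (hb' p x _ v le_rfl le_rfl).trans ?_
    gcongr; linarith
  · have hline : HasDerivAt (fun s : ℝ => x + incr ℓ w τ (v + s • h j)) (τ j • w j) 0 := by
      simp only [map_add, map_smul, hw]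
      simpa using (((hasDerivAt_id (0 : ℝ)).smul_const (τ j • w j)).const_add
        (incr ℓ w τ v)).const_add x
    have h2 := (hf.hasFDerivAt' p (x + incr ℓ w τ (v + (0 : ℝ) • h j))).comp_hasDerivAt 0 hline
    have h3 := h2.clm_apply (hasDerivAt_const (0 : ℝ) (w j))
    simpa using h3

variable {w : J → E} {f : E → ℝ} {f' : E → E →L[ℝ] ℝ} {f'' : E → E →L[ℝ] E →L[ℝ] ℝ}
  {τ₁ τ₂ σ₁ σ₂ : ℝ → J → ℝ} {κ : J → ℝ} {s : Set ℝ}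

/-- Along a moving base point `S z`, the Gaussian average of `f` with variances decreasing at the
rate `κ` satisfies the chain rule together with the backward heat equation. -/
theorem hasDerivAt_avg_moving (hμ : ExpMoments μ) (hfr : GaussianFrame μ ℓ h)
    (hf : Jet (fun _ : ℝ => f) (fun _ => f') (fun _ => f''))
    (hT₁ : BddCont fun z => incr ℓ w (τ₁ z)) (hs : IsOpen s)
    (hd₁ : ∀ z ∈ s, ∀ j, HasDerivAt (fun z => τ₁ z j) (σ₁ z j) z)
    (hσ₁ : ∀ j, ContinuousOn (fun z => σ₁ z j) s)
    (hκ₁ : ∀ z ∈ s, ∀ j, σ₁ z j * τ₁ z j = -(κ j / 2))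
    {S S' : ℝ → E} (hS : ∀ z ∈ s, HasDerivAt S (S' z) z) (hS' : ContinuousOn S' s)
    {z : ℝ} (hz : z ∈ s) :
    HasDerivAt (fun ζ => avg μ (fun z => incr ℓ w (τ₁ z)) (fun _ => f) ζ (S ζ))
      (avg μ (fun z => incr ℓ w (τ₁ z)) (fun _ => f') z (S z) (S' z)
        - ∑ j, κ j / 2 * avg μ (fun z => incr ℓ w (τ₁ z)) (fun _ => f'') z (S z) (w j) (w j)) z := by
  obtain ⟨R, hR, hTR⟩ := hT₁.bdd
  have hσc : ContinuousAt (fun z => incr ℓ w (σ₁ z)) z := by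
    have : ContinuousOn (fun z => incr ℓ w (σ₁ z)) s := by unfold incr; fun_prop
    exact this.continuousAt (hs.mem_nhds hz)
  have ev1 : ∀ᶠ ζ in 𝓝 z, ζ ∈ s := hs.mem_nhds hz
  have ev2 : ∀ᶠ ζ in 𝓝 z, ‖S ζ‖ < ‖S z‖ + 1 :=
    (hS z hz).continuousAt.norm.eventually_lt continuousAt_const (by simp)
  have ev3 : ∀ᶠ ζ in 𝓝 z, ‖S' ζ‖ < ‖S' z‖ + 1 :=
    (hS'.continuousAt (hs.mem_nhds hz)).norm.eventually_lt continuousAt_const (by simp)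
  have ev4 : ∀ᶠ ζ in 𝓝 z, ‖incr ℓ w (σ₁ ζ)‖ < ‖incr ℓ w (σ₁ z)‖ + 1 :=
    hσc.norm.eventually_lt continuousAt_const (by simp)
  obtain ⟨K, hK, hb⟩ := hf.tame.exp_growth_shift (B := B) (‖S z‖ + 1) R
  obtain ⟨K', hK', hb'⟩ := hf.tame'.exp_growth_shift (B := B) (‖S z‖ + 1) R
  set a := ‖S' z‖ + 1 with ha
  set b := ‖incr ℓ w (σ₁ z)‖ + 1 with hb0
  have ha0 : 0 ≤ a := by positivity
  have hb00 : 0 ≤ b := by positivity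
  have hcont : Continuous f' := hf.tame'.continuous_apply 0
  have main := hasDerivAt_integral_of_exp_bound hμ (z₀ := z) (K := K + (K' + (a + b)))
    (φ := fun ζ v => f (S ζ + incr ℓ w (τ₁ ζ) v))
    (φ' := fun ζ v => f' (S ζ + incr ℓ w (τ₁ ζ) v) (S' ζ + incr ℓ w (σ₁ ζ) v))
    (ev1.and (ev2.and (ev3.and ev4)))
    (fun ζ _ => (hf.tame.continuous_apply 0).comp (by fun_prop)) (by fun_prop)
    (fun ζ hζ v => ?_) (fun ζ hζ v => ?_) (fun ζ hζ v => ?_)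
  · refine main.congr_deriv ?_
    have i1 : Integrable (fun v => f' (S z + incr ℓ w (τ₁ z) v) (S' z)) μ :=
      (hf.tame'.apply (S' z)).integrable_shift hμ z _ _
    have i2 : Integrable (fun v => f' (S z + incr ℓ w (τ₁ z) v) (incr ℓ w (σ₁ z) v)) μ := by
      have h1 : ∀ v, f' (S z + incr ℓ w (τ₁ z) v) (incr ℓ w (σ₁ z) v)
          = ∑ j, σ₁ z j * (f' (S z + incr ℓ w (τ₁ z) v) (w j) * ℓ j v) := fun v => by
        rw [incr_apply ℓ w (σ₁ z), map_sum]
        refine Finset.sum_congr rfl fun j _ => ?_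
        rw [map_smul, smul_eq_mul]; ring
      simp only [h1]
      exact integrable_finsetSum _ fun j _ =>
        ((hf.tame'.apply (w j)).integrable_shift_mul hμ z _ _ (ℓ j)).const_mul _
    simp only [map_add]
    rw [integral_add i1 i2, integral_fderiv_incr hμ hfr w hf z (S z) (τ₁ z) (σ₁ z), avg, avg,
      ContinuousLinearMap.integral_apply (hf.tame'.integrable_shift hμ z _ _), sub_eq_add_neg,
      ← Finset.sum_neg_distrib]
    congr 1
    refine Finset.sum_congr rfl fun j _ => ?_
    rw [hκ₁ z hz j, ContinuousLinearMap.integral_apply (hf.tame''.integrable_shift hμ z _ _),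
      ContinuousLinearMap.integral_apply ((hf.tame''.apply (w j)).integrable_shift hμ z _ _)]
    ring
  · refine (hb ζ (S ζ) _ v hζ.2.1.le (hTR ζ)).trans ?_
    gcongr; linarith
  · have h1 : ‖S' ζ + incr ℓ w (σ₁ ζ) v‖ ≤ exp ((a + b) * (1 + ‖v‖)) := by
      have h2 : ‖S' ζ + incr ℓ w (σ₁ ζ) v‖ ≤ a + b * ‖v‖ :=
        (norm_add_le _ _).trans (add_le_add hζ.2.2.1.le
          ((incr ℓ w (σ₁ ζ)).le_of_opNorm_le hζ.2.2.2.le v))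
      have h3 := add_one_le_exp ((a + b) * (1 + ‖v‖))
      nlinarith [mul_nonneg ha0 (norm_nonneg v)]
    calc |f' (S ζ + incr ℓ w (τ₁ ζ) v) (S' ζ + incr ℓ w (σ₁ ζ) v)|
        ≤ ‖f' (S ζ + incr ℓ w (τ₁ ζ) v)‖ * ‖S' ζ + incr ℓ w (σ₁ ζ) v‖ := by
          rw [← Real.norm_eq_abs]; exact ContinuousLinearMap.le_opNorm _ _
      _ ≤ exp (K' * (1 + ‖v‖)) * exp ((a + b) * (1 + ‖v‖)) := by
          gcongr
          exact hb' ζ (S ζ) _ v hζ.2.1.le (hTR ζ)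
      _ = exp ((K' + (a + b)) * (1 + ‖v‖)) := by rw [← exp_add]; ring_nf
      _ ≤ _ := exp_le_exp.2 (mul_le_mul_of_nonneg_right (by linarith) (by positivity))
  · exact (hf.hasFDerivAt ζ _).comp_hasDerivAt ζ
      ((hS ζ hζ.1).add (hasDerivAt_incr ℓ w (hd₁ ζ hζ.1) v))

/-- Variance is moved, at the rates `κ j`, from the inner Gaussian average `H` to the outer one. The
second derivatives of `H` cancel between the two levels, and what is left is the Jensen gap of the
nonlinearity `g` that separates the levels. -/
theorem hasDerivAt_two_level [IsProbabilityMeasure μ] (hμ : ExpMoments μ)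
    (hfr : GaussianFrame μ ℓ h) (hf : Jet (fun _ : ℝ => f) (fun _ => f') (fun _ => f''))
    (hpos : TamePos fun _ : ℝ => f)
    (hT₁ : BddCont fun z => incr ℓ w (τ₁ z)) (hT₂ : BddCont fun z => incr ℓ w (τ₂ z))
    (hs : IsOpen s)
    (hd₁ : ∀ z ∈ s, ∀ j, HasDerivAt (fun z => τ₁ z j) (σ₁ z j) z)
    (hσ₁ : ∀ j, ContinuousOn (fun z => σ₁ z j) s)
    (hκ₁ : ∀ z ∈ s, ∀ j, σ₁ z j * τ₁ z j = -(κ j / 2))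
    (hd₂ : ∀ z ∈ s, ∀ j, HasDerivAt (fun z => τ₂ z j) (σ₂ z j) z)
    (hσ₂ : ∀ j, ContinuousOn (fun z => σ₂ z j) s)
    (hκ₂ : ∀ z ∈ s, ∀ j, σ₂ z j * τ₂ z j = κ j / 2)
    {g : ℝ → ℝ} {c α : ℝ} (hg : ∀ y, 0 < y → HasDerivAt g (c * y ^ (α - 1)) y)
    (hgt : ∀ F : ℝ → E → ℝ, TamePos F → Tame fun z x => g (F z x)) {z : ℝ} (hz : z ∈ s) (x : E) :
    HasDerivAt (fun ζ => avg μ (fun z => incr ℓ w (τ₂ z))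
        (fun z y => g (avg μ (fun z => incr ℓ w (τ₁ z)) (fun _ => f) z y)) ζ x)
      (avg μ (fun z => incr ℓ w (τ₂ z))
        (fun z y => c * (α - 1) / 2 * avg μ (fun z => incr ℓ w (τ₁ z)) (fun _ => f) z y ^ (α - 2)
          * ∑ j, κ j * avg μ (fun z => incr ℓ w (τ₁ z)) (fun _ => f') z y (w j) ^ 2) z x) z := by
  set T₁ := fun z => incr ℓ w (τ₁ z) with hT₁def
  set H := avg μ T₁ (fun _ => f) with hH
  set H' := avg μ T₁ (fun _ => f') with hH'
  set H'' := avg μ T₁ (fun _ => f'') with hH''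
  have jH : Jet H H' H'' := hf.avg hμ hT₁
  have pH : TamePos H := hpos.avg hμ hT₁
  have jg := jH.comp pH hg (hgt H pH)
  obtain ⟨R, hR, hTR⟩ := hT₂.bdd
  have hσc : ContinuousOn (fun z => incr ℓ w (σ₂ z)) s := by unfold incr; fun_prop
  have ev1 : ∀ᶠ ζ in 𝓝 z, ζ ∈ s := hs.mem_nhds hz
  have ev2 : ∀ᶠ ζ in 𝓝 z, ‖incr ℓ w (σ₂ ζ)‖ < ‖incr ℓ w (σ₂ z)‖ + 1 :=
    (hσc.continuousAt (hs.mem_nhds hz)).norm.eventually_lt continuousAt_const (by simp)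
  set b := ‖incr ℓ w (σ₂ z)‖ + 1 with hb0
  have hb00 : 0 ≤ b := by positivity
  -- the part of the derivative of `g ∘ H` that comes from the change of the inner variance
  set Q : ℝ → E → ℝ := fun z y =>
    c * H z y ^ (α - 1) * -∑ j, κ j / 2 * H'' z y (w j) (w j) with hQ
  have tQ : Tame Q := by
    have h1 := Tame.sum Finset.univ fun j _ =>
      ((jH.tame''.apply (w j)).apply (w j)).const_mul (κ j / 2)
    have h2 := ((pH.rpow (α - 1)).tame.const_mul c).mul (h1.const_mul (-1))
    simpa only [neg_one_mul] using h2
  obtain ⟨K, hK, hb⟩ := (hgt H pH).exp_growth_shift (B := B) ‖x‖ R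
  obtain ⟨K', hK', hb'⟩ := jg.tame'.exp_growth_shift (B := B) ‖x‖ R
  obtain ⟨L, hL, hbL⟩ := tQ.exp_growth_shift (B := B) ‖x‖ R
  have c1 : Continuous fun v => (c * H z (x + incr ℓ w (τ₂ z) v) ^ (α - 1))
      • H' z (x + incr ℓ w (τ₂ z) v) := (jg.tame'.continuous_apply z).comp (by fun_prop)
  have c2 : Continuous fun v => Q z (x + incr ℓ w (τ₂ z) v) :=
    (tQ.continuous_apply z).comp (by fun_prop)
  have main := hasDerivAt_integral_of_exp_bound hμ (z₀ := z) (K := K + (K' + b + L + 1))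
    (φ := fun ζ v => g (H ζ (x + incr ℓ w (τ₂ ζ) v)))
    (φ' := fun ζ v => ((c * H ζ (x + incr ℓ w (τ₂ ζ) v) ^ (α - 1))
      • H' ζ (x + incr ℓ w (τ₂ ζ) v)) (incr ℓ w (σ₂ ζ) v) + Q ζ (x + incr ℓ w (τ₂ ζ) v))
    (ev1.and ev2)
    (fun ζ _ => ((hgt H pH).continuous_apply ζ).comp (by fun_prop))
    ((c1.clm_apply (incr ℓ w (σ₂ z)).continuous).add c2)
    (fun ζ hζ v => ?_) (fun ζ hζ v => ?_) (fun ζ hζ v => ?_)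
  · refine main.congr_deriv ?_
    have i1 : Integrable (fun v => ((c * H z (x + incr ℓ w (τ₂ z) v) ^ (α - 1))
        • H' z (x + incr ℓ w (τ₂ z) v)) (incr ℓ w (σ₂ z) v)) μ := by
      refine integrable_exp_growth hμ (K := K' + b)
        (c1.clm_apply (incr ℓ w (σ₂ z)).continuous) fun v => ?_
      have h1 : ‖incr ℓ w (σ₂ z) v‖ ≤ exp (b * (1 + ‖v‖)) := by
        have h2 := (incr ℓ w (σ₂ z)).le_of_opNorm_le (by linarith : _ ≤ b) v
        have h3 := add_one_le_exp (b * (1 + ‖v‖))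
        nlinarith
      rw [← Real.norm_eq_abs]
      refine (ContinuousLinearMap.le_opNorm _ _).trans ?_
      rw [add_mul, exp_add]
      gcongr
      exact hb' z x _ v le_rfl (hTR z)
    rw [integral_add i1 (tQ.integrable_shift hμ z x _),
      integral_fderiv_incr hμ hfr w jg z x (τ₂ z) (σ₂ z)]
    have i2 : ∀ j, Integrable (fun v => ((c * H z (x + incr ℓ w (τ₂ z) v) ^ (α - 1))
        • H'' z (x + incr ℓ w (τ₂ z) v) + ((c * (α - 1) * H z (x + incr ℓ w (τ₂ z) v) ^ (α - 2))
          • H' z (x + incr ℓ w (τ₂ z) v)).smulRight (H' z (x + incr ℓ w (τ₂ z) v))) (w j) (w j))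
        μ := fun j => ((jg.tame''.apply (w j)).apply (w j)).integrable_shift hμ z x _
    simp only [← integral_const_mul]
    rw [← integral_finsetSum _ fun j _ => (i2 j).const_mul _, ← integral_add
      (integrable_finsetSum _ fun j _ => (i2 j).const_mul _) (tQ.integrable_shift hμ z x _)]
    -- the terms with `H''` in the integrand cancel pointwise
    refine integral_congr_ae (ae_of_all _ fun v => ?_)
    simp only [hQ, hκ₂ z hz, _root_.add_apply, _root_.smul_apply,
      ContinuousLinearMap.smulRight_apply, smul_eq_mul]
    rw [mul_neg, Finset.mul_sum, Finset.mul_sum, ← Finset.sum_neg_distrib,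
      ← Finset.sum_add_distrib]
    refine Finset.sum_congr rfl fun j _ => ?_
    ring
  · refine (hb ζ x _ v le_rfl (hTR ζ)).trans ?_
    gcongr; linarith
  · have h1 : ‖incr ℓ w (σ₂ ζ) v‖ ≤ exp (b * (1 + ‖v‖)) := by
      have h2 := (incr ℓ w (σ₂ ζ)).le_of_opNorm_le hζ.2.le v
      have h3 := add_one_le_exp (b * (1 + ‖v‖))
      nlinarith
    have h4 : |((c * H ζ (x + incr ℓ w (τ₂ ζ) v) ^ (α - 1))
        • H' ζ (x + incr ℓ w (τ₂ ζ) v)) (incr ℓ w (σ₂ ζ) v)|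
        ≤ exp ((K' + b + L) * (1 + ‖v‖)) := by
      rw [← Real.norm_eq_abs]
      refine (ContinuousLinearMap.le_opNorm _ _).trans ?_
      calc _ ≤ exp (K' * (1 + ‖v‖)) * exp (b * (1 + ‖v‖)) := by
            gcongr
            exact hb' ζ x _ v le_rfl (hTR ζ)
        _ = exp ((K' + b) * (1 + ‖v‖)) := by rw [← exp_add]; ring_nf
        _ ≤ _ := exp_le_exp.2 (mul_le_mul_of_nonneg_right (by linarith) (by positivity))
    have h5 : |Q ζ (x + incr ℓ w (τ₂ ζ) v)| ≤ exp ((K' + b + L) * (1 + ‖v‖)) :=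
      (hbL ζ x _ v le_rfl (hTR ζ)).trans (by gcongr; linarith)
    have h6 : 2 ≤ exp (1 * (1 + ‖v‖)) := by
      have := add_one_le_exp (1 * (1 + ‖v‖))
      linarith [norm_nonneg v]
    calc _ ≤ 2 * exp ((K' + b + L) * (1 + ‖v‖)) := by
          refine (abs_add_le _ _).trans ?_
          linarith
      _ ≤ exp (1 * (1 + ‖v‖)) * exp ((K' + b + L) * (1 + ‖v‖)) := by gcongr
      _ = exp ((K' + b + L + 1) * (1 + ‖v‖)) := by rw [← exp_add]; ring_nf
      _ ≤ _ := exp_le_exp.2 (mul_le_mul_of_nonneg_right (by linarith) (by positivity))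
  · have h1 : HasDerivAt (fun ζ => H ζ (x + incr ℓ w (τ₂ ζ) v)) _ ζ :=
      hasDerivAt_avg_moving hμ hfr hf hT₁ hs hd₁ hσ₁ hκ₁
        (S := fun ζ => x + incr ℓ w (τ₂ ζ) v) (S' := fun ζ => incr ℓ w (σ₂ ζ) v)
        (fun ζ hζ => (hasDerivAt_incr ℓ w (hd₂ ζ hζ) v).const_add x)
        (by fun_prop) hζ.1
    refine ((hg _ (pH.pos ζ _)).comp ζ h1).congr_deriv ?_
    simp only [hQ, _root_.smul_apply, smul_eq_mul]
    ring

end TwoLevel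

/-! ### The hierarchy of tilted Gaussian averages -/

section Hierarchy

variable {E B : Type*} [NormedAddCommGroup E] [NormedSpace ℝ E] [NormedAddCommGroup B]
  [NormedSpace ℝ B] [MeasurableSpace B]

/-- The `k`-th level of the hierarchy started from `Z₀`, as a function of the field `x` to which the
increments of the levels above `k` have been added. -/
def lev (μ : Measure B) (T : ℕ → B →L[ℝ] E) (mv : ℕ → ℝ) (Z₀ : E → ℝ) : ℕ → E → ℝ
  | 0 => Z₀
  | k + 1 => fun x => ∫ v, lev μ T mv Z₀ k (x + T (k + 1) v) ^ (mv (k + 1) / mv k) ∂μ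

/-- The average over the `k`-th increment under the law tilted by the `k`-th level. -/
def tilt (μ : Measure B) (T : ℕ → B →L[ℝ] E) (mv : ℕ → ℝ) (Z₀ : E → ℝ) (k : ℕ) (f : E → ℝ)
    (x : E) : ℝ :=
  ∫ v, lev μ T mv Z₀ (k - 1) (x + T k v) ^ (mv k / mv (k - 1)) / lev μ T mv Z₀ k x
    * f (x + T k v) ∂μ

/-- The composition of the tilted averages with indices `lo, …, hi`, the largest applied last. -/
def tiltProd (μ : Measure B) (T : ℕ → B →L[ℝ] E) (mv : ℕ → ℝ) (Z₀ : E → ℝ) (lo : ℕ) :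
    ℕ → (E → ℝ) → E → ℝ
  | 0, f => f
  | hi + 1, f => if lo ≤ hi + 1 then tilt μ T mv Z₀ (hi + 1) (tiltProd μ T mv Z₀ lo hi f) else f

variable {μ : Measure B} {mv : ℕ → ℝ} {Z₀ : E → ℝ}

theorem lev_congr {T T' : ℕ → B →L[ℝ] E} (k : ℕ) (h : ∀ i, i ≤ k → T i = T' i) :
    lev μ T mv Z₀ k = lev μ T' mv Z₀ k := by
  induction k with
  | zero => rfl
  | succ k ih =>
    simp only [lev]
    rw [ih fun i hi => h i (hi.trans k.le_succ), h (k + 1) le_rfl]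

theorem tiltProd_of_lt (T : ℕ → B →L[ℝ] E) {lo hi : ℕ} (h : hi < lo) (f : E → ℝ) :
    tiltProd μ T mv Z₀ lo hi f = f := by
  cases hi with
  | zero => rfl
  | succ hi => simp [tiltProd, Nat.not_le.2 h]

theorem tiltProd_succ (T : ℕ → B →L[ℝ] E) {lo hi : ℕ} (h : lo ≤ hi + 1) (f : E → ℝ) :
    tiltProd μ T mv Z₀ lo (hi + 1) f
      = tilt μ T mv Z₀ (hi + 1) (tiltProd μ T mv Z₀ lo hi f) := by
  simp [tiltProd, h]

theorem tilt_succ_eq (T : ℕ → B →L[ℝ] E) (k : ℕ) (f : E → ℝ) (x : E) :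
    tilt μ T mv Z₀ (k + 1) f x
      = (∫ v, lev μ T mv Z₀ k (x + T (k + 1) v) ^ (mv (k + 1) / mv k) * f (x + T (k + 1) v) ∂μ)
        / lev μ T mv Z₀ (k + 1) x := by
  rw [tilt, ← integral_div]
  simp only [Nat.add_sub_cancel]
  congr 1 with v
  ring

variable [BorelSpace B] [SecondCountableTopology B] [IsProbabilityMeasure μ]
  {P : Type*} [TopologicalSpace P] [FirstCountableTopology P] {T : P → ℕ → B →L[ℝ] E}

theorem tamePos_lev (hμ : ExpMoments μ) (hT : ∀ k, BddCont fun p => T p k)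
    (hZ : TamePos fun _ : P => Z₀) (k : ℕ) : TamePos fun p => lev μ (T p) mv Z₀ k := by
  induction k with
  | zero => exact hZ
  | succ k ih => exact (ih.rpow _).avg hμ (hT (k + 1))

theorem Tame.tilt_succ (hμ : ExpMoments μ) (hT : ∀ k, BddCont fun p => T p k)
    (hZ : TamePos fun _ : P => Z₀) (k : ℕ) {f : P → E → ℝ} (hf : Tame f) :
    Tame fun p => tilt μ (T p) mv Z₀ (k + 1) (f p) := by
  have h1 := ((((tamePos_lev (mv := mv) hμ hT hZ k).rpow (mv (k + 1) / mv k)).tame.mul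
    hf).avg hμ (hT (k + 1))).div (tamePos_lev (mv := mv) hμ hT hZ (k + 1))
  refine h1.congr fun p x => ?_
  exact (tilt_succ_eq (T p) k (f p) x).symm

theorem Tame.tiltProd (hμ : ExpMoments μ) (hT : ∀ k, BddCont fun p => T p k)
    (hZ : TamePos fun _ : P => Z₀) (lo hi : ℕ) {f : P → E → ℝ} (hf : Tame f) :
    Tame fun p => tiltProd μ (T p) mv Z₀ lo hi (f p) := by
  induction hi with
  | zero => exact hf
  | succ hi ih =>
    by_cases h : lo ≤ hi + 1
    · simpa only [tiltProd_succ _ h] using ih.tilt_succ hμ hT hZ hi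
    · simpa only [tiltProd_of_lt _ (not_le.1 h)] using hf

theorem lev_mul_tilt (hμ : ExpMoments μ) (hT : ∀ k, BddCont fun p => T p k)
    (hZ : TamePos fun _ : P => Z₀) (k : ℕ) (f : E → ℝ) (p : P) (x : E) :
    lev μ (T p) mv Z₀ (k + 1) x * tilt μ (T p) mv Z₀ (k + 1) f x
      = ∫ v, lev μ (T p) mv Z₀ k (x + T p (k + 1) v) ^ (mv (k + 1) / mv k)
          * f (x + T p (k + 1) v) ∂μ := by
  rw [tilt_succ_eq, mul_div_cancel₀ _ ((tamePos_lev hμ hT hZ (k + 1)).pos p x).ne']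

theorem tiltProd_sum (hμ : ExpMoments μ) (hT : ∀ k, BddCont fun p => T p k)
    (hZ : TamePos fun _ : P => Z₀) (lo hi : ℕ) {ι : Type*} [Fintype ι] (c : ι → ℝ)
    {f : ι → P → E → ℝ} (hf : ∀ i, Tame (f i)) (p : P) :
    tiltProd μ (T p) mv Z₀ lo hi (fun x => ∑ i, c i * f i p x)
      = fun x => ∑ i, c i * tiltProd μ (T p) mv Z₀ lo hi (f i p) x := by
  induction hi with
  | zero => rfl
  | succ hi ih =>
    by_cases h : lo ≤ hi + 1
    · simp only [tiltProd_succ _ h, ih]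
      ext x
      have hV := tamePos_lev (mv := mv) hμ hT hZ hi
      simp only [tilt_succ_eq, ← mul_div_assoc, ← Finset.sum_div, Finset.mul_sum]
      congr 1
      rw [integral_finsetSum]
      · refine Finset.sum_congr rfl fun i _ => ?_
        rw [← integral_const_mul]
        congr 1 with v
        ring
      · intro i _
        exact (((hV.rpow _).tame).mul (((hf i).tiltProd hμ hT hZ lo hi).const_mul
          (c i))).integrable_shift hμ p x _
    · simp only [tiltProd_of_lt _ (not_le.1 h)]

/-- The levels are twice differentiable, and their logarithmic derivatives in the directions `e i`
are obtained from those of `Z₀` by the tilted averages. -/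
theorem exists_jet_lev (hμ : ExpMoments μ) (hT : ∀ k, BddCont fun p => T p k)
    (hZ : TamePos fun _ : P => Z₀) {Z' : E → E →L[ℝ] ℝ} {Z'' : E → E →L[ℝ] E →L[ℝ] ℝ}
    (jZ : Jet (fun _ : P => Z₀) (fun _ => Z') (fun _ => Z'')) {ι : Type*} {e : ι → E}
    {γ : ι → E → ℝ} {b : ℝ}
    (hZγ : ∀ x i, Z' x (e i) = b * (Z₀ x * γ i x)) {r : ℕ} (hmv0 : mv 0 = 1)
    (hmv : ∀ k, 1 ≤ k → k ≤ r → mv k ≠ 0) (k : ℕ) (hk : k ≤ r) :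
    ∃ (f' : P → E → E →L[ℝ] ℝ) (f'' : P → E → E →L[ℝ] E →L[ℝ] ℝ),
      Jet (fun p => lev μ (T p) mv Z₀ k) f' f'' ∧
      ∀ p x i, f' p x (e i) = mv k * b * (lev μ (T p) mv Z₀ k x
        * tiltProd μ (T p) mv Z₀ 1 k (γ i) x) := by
  induction k with
  | zero => exact ⟨_, _, jZ, fun p x i => by rw [hZγ, hmv0, one_mul]; rfl⟩
  | succ k ih =>
    obtain ⟨f', f'', hj, hf'⟩ := ih (by omega)
    have hV := tamePos_lev (mv := mv) hμ hT hZ k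
    have hmk : mv k ≠ 0 := by
      rcases Nat.eq_zero_or_pos k with rfl | h
      · rw [hmv0]; exact one_ne_zero
      · exact hmv k h (by omega)
    set α := mv (k + 1) / mv k with hα
    have hjα := hj.comp hV (g := fun y => y ^ α) (c := α) (α := α)
      (fun y hy => Real.hasDerivAt_rpow_const (Or.inl hy.ne')) (hV.rpow α).tame
    refine ⟨_, _, hjα.avg hμ (hT (k + 1)), fun p x i => ?_⟩
    rw [avg, ContinuousLinearMap.integral_apply (hjα.tame'.integrable_shift hμ p x _),
      tiltProd_succ _ (by omega), lev_mul_tilt hμ hT hZ, ← integral_const_mul]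
    congr 1 with v
    rw [_root_.smul_apply, smul_eq_mul, hf', rpow_sub_one (hV.pos p _).ne']
    have h0 := (hV.pos p (x + T p (k + 1) v)).ne'
    rw [hα]
    field_simp

end Hierarchy

section Shift

variable {B J ι : Type*} [NormedAddCommGroup B] [NormedSpace ℝ B] [MeasurableSpace B]
  [BorelSpace B] [SecondCountableTopology B] [Fintype J] [Fintype ι]
  {μ : Measure B} [IsProbabilityMeasure μ] {ℓ : J → B →L[ℝ] ℝ} {h : J → B}

/-- Standard deviations `τ z k j` depending on `z` such that, for `z ∈ s`, variance is moved from
level `k` to level `k + 1` at the rates `κ j`, all other levels being unaffected. -/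
structure VarianceShift (τ : ℝ → ℕ → J → ℝ) (κ : J → ℝ) (k : ℕ) (s : Set ℝ) : Prop where
  cont : ∀ i j, Continuous fun z => τ z i j
  bdd : ∀ i j, ∃ R, ∀ z, |τ z i j| ≤ R
  const : ∀ i, i ≠ k → i ≠ k + 1 → ∀ z z', τ z i = τ z' i
  deriv_lower : ∃ σ : ℝ → J → ℝ, (∀ z ∈ s, ∀ j, HasDerivAt (fun z => τ z k j) (σ z j) z) ∧
    (∀ j, ContinuousOn (fun z => σ z j) s) ∧ ∀ z ∈ s, ∀ j, σ z j * τ z k j = -(κ j / 2)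
  deriv_upper : ∃ σ : ℝ → J → ℝ, (∀ z ∈ s, ∀ j, HasDerivAt (fun z => τ z (k + 1) j) (σ z j) z) ∧
    (∀ j, ContinuousOn (fun z => σ z j) s) ∧ ∀ z ∈ s, ∀ j, σ z j * τ z (k + 1) j = κ j / 2

theorem VarianceShift.bddCont {B J E : Type*} [NormedAddCommGroup B] [NormedSpace ℝ B]
    [NormedAddCommGroup E] [NormedSpace ℝ E] [Fintype J] {ℓ : J → B →L[ℝ] ℝ} {w : J → E}
    {τ : ℝ → ℕ → J → ℝ} {κ : J → ℝ} {k : ℕ} {s : Set ℝ} (hτ : VarianceShift τ κ k s) (i : ℕ) :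
    BddCont fun z => incr ℓ w (τ z i) :=
  bddCont_incr ℓ w (hτ.cont i) (hτ.bdd i)

/-- Differentiation in the parameter commutes with an average whose increment does not depend on
it. -/
theorem hasDerivAt_avg_const {E B : Type*} [NormedAddCommGroup E] [NormedSpace ℝ E]
    [NormedAddCommGroup B] [NormedSpace ℝ B] [MeasurableSpace B] [BorelSpace B] {μ : Measure B}
    (hμ : ExpMoments μ) {φ φ' : ℝ → E → ℝ} (hφ : Tame φ) (hφ' : Tame φ') {s : Set ℝ}
    (hs : IsOpen s) (hd : ∀ z ∈ s, ∀ x, HasDerivAt (fun ζ => φ ζ x) (φ' z x) z)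
    (S : B →L[ℝ] E) {z : ℝ} (hz : z ∈ s) (x : E) :
    HasDerivAt (fun ζ => ∫ v, φ ζ (x + S v) ∂μ) (∫ v, φ' z (x + S v) ∂μ) z := by
  obtain ⟨K, hK, hb⟩ := hφ.exp_growth_shift (B := B) ‖x‖ ‖S‖
  obtain ⟨K', hK', hb'⟩ := hφ'.exp_growth_shift (B := B) ‖x‖ ‖S‖
  refine hasDerivAt_integral_of_exp_bound hμ (K := K + K') (hs.mem_nhds hz)
    (fun ζ _ => (hφ.continuous_apply ζ).comp (by fun_prop : Continuous fun v => x + S v))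
    ((hφ'.continuous_apply z).comp (by fun_prop : Continuous fun v => x + S v)) (fun ζ _ v => ?_) (fun ζ _ v => ?_)
    fun ζ hζ v => hd ζ hζ _
  · exact (hb ζ x S v le_rfl le_rfl).trans (by gcongr; linarith)
  · exact (hb' ζ x S v le_rfl le_rfl).trans (by gcongr; linarith)

variable {w : J → ι → ℝ} {τ : ℝ → ℕ → J → ℝ} {κ : J → ℝ} {s : Set ℝ} {mv : ℕ → ℝ}
  {Z₀ : (ι → ℝ) → ℝ} {Z' : (ι → ℝ) → (ι → ℝ) →L[ℝ] ℝ}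
  {Z'' : (ι → ℝ) → (ι → ℝ) →L[ℝ] (ι → ℝ) →L[ℝ] ℝ} {γ : ι → (ι → ℝ) → ℝ} {b : ℝ} {r k : ℕ}

/-- The quadratic form in the tilted weights at level `k + 1` that is produced by moving variance at
the rates `κ` in the directions `w`. -/
def shiftForm (μ : Measure B) (T : ℕ → B →L[ℝ] (ι → ℝ)) (mv : ℕ → ℝ) (Z₀ : (ι → ℝ) → ℝ)
    (γ : ι → (ι → ℝ) → ℝ) (w : J → ι → ℝ) (κ : J → ℝ) (k : ℕ) (x : ι → ℝ) : ℝ :=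
  ∑ j, κ j * (∑ i, w j i * tiltProd μ T mv Z₀ 1 k (γ i) x) ^ 2

theorem tame_shiftForm (hμ : ExpMoments μ) (hτ : VarianceShift τ κ k s)
    (hZ : TamePos fun _ : ℝ => Z₀) (hγ : ∀ i, Tame fun _ : ℝ => γ i) (i : ℕ) :
    Tame fun z => shiftForm μ (fun i => incr ℓ w (τ z i)) mv Z₀ γ w κ i := by
  refine Tame.sum _ fun j _ => Tame.const_mul _ ?_
  have h1 : Tame fun z x => ∑ i', w j i' *
      tiltProd μ (fun i => incr ℓ w (τ z i)) mv Z₀ 1 i (γ i') x :=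
    Tame.sum _ fun i' _ => ((hγ i').tiltProd hμ hτ.bddCont hZ 1 i).const_mul _
  simpa only [sq] using h1.mul h1

variable [DecidableEq J] [DecidableEq ι]

/-- The effect of the shift on a nonlinearity `g` applied to level `k + 1` and averaged over the
increment of the next level, expressed through the tilted weights. -/
theorem hasDerivAt_avg_comp_lev (hμ : ExpMoments μ) (hfr : GaussianFrame μ ℓ h)
    (hs : IsOpen s) (hτ : VarianceShift τ κ (k + 1) s) (hZ : TamePos fun _ : ℝ => Z₀)
    (jZ : Jet (fun _ : ℝ => Z₀) (fun _ => Z') (fun _ => Z''))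
    (hZγ : ∀ x i, Z' x (Pi.single i 1) = b * (Z₀ x * γ i x)) (hmv0 : mv 0 = 1)
    (hmv : ∀ k, 1 ≤ k → k ≤ r → mv k ≠ 0) (hk : k + 1 ≤ r)
    {g : ℝ → ℝ} {c α : ℝ} (hg : ∀ y, 0 < y → HasDerivAt g (c * y ^ (α - 1)) y)
    (hgt : ∀ F : ℝ → (ι → ℝ) → ℝ, TamePos F → Tame fun z x => g (F z x)) {z : ℝ} (hz : z ∈ s)
    (x : ι → ℝ) :
    HasDerivAt (fun ζ => avg μ (fun z => incr ℓ w (τ z (k + 2)))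
        (fun z y => g (lev μ (fun i => incr ℓ w (τ z i)) mv Z₀ (k + 1) y)) ζ x)
      (c * (α - 1) / 2 * (mv (k + 1) * b) ^ 2 * avg μ (fun z => incr ℓ w (τ z (k + 2)))
        (fun z y => lev μ (fun i => incr ℓ w (τ z i)) mv Z₀ (k + 1) y ^ α
          * shiftForm μ (fun i => incr ℓ w (τ z i)) mv Z₀ γ w κ (k + 1) y) z x) z := by
  obtain ⟨σ₁, hd₁, hσ₁, hκ₁⟩ := hτ.deriv_lower
  obtain ⟨σ₂, hd₂, hσ₂, hκ₂⟩ := hτ.deriv_upper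
  have hT := hτ.bddCont (ℓ := ℓ) (w := w)
  obtain ⟨f', f'', hj, -⟩ := exists_jet_lev hμ hT hZ jZ hZγ hmv0 hmv k (by omega)
  obtain ⟨H', H'', hjH, hH'⟩ := exists_jet_lev hμ hT hZ jZ hZγ hmv0 hmv (k + 1) hk
  have hlev : ∀ z', lev μ (fun i => incr ℓ w (τ z' i)) mv Z₀ k
      = lev μ (fun i => incr ℓ w (τ z i)) mv Z₀ k := fun z' =>
    lev_congr k fun i hi => by rw [hτ.const i (by omega) (by omega) z' z]
  -- the levels up to `k` do not see the shift, so the inner function may be frozen at `z`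
  set f₀ := lev μ (fun i => incr ℓ w (τ z i)) mv Z₀ k with hf₀
  have pos₀ : TamePos fun _ : ℝ => f₀ := by
    simpa only [hlev] using tamePos_lev (mv := mv) hμ hT hZ k
  have j₀ : Jet (fun _ : ℝ => f₀) (fun _ => f' z) (fun _ => f'' z) :=
    ⟨pos₀.tame, hj.tame'.comp_param (continuous_const (y := z)),
      hj.tame''.comp_param (continuous_const (y := z)), fun _ => hj.hasFDerivAt z,
      fun _ => hj.hasFDerivAt' z⟩
  set δ := mv (k + 1) / mv k with hδ
  have jδ := j₀.comp pos₀ (g := fun y => y ^ δ) (c := δ) (α := δ)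
      (fun y hy => Real.hasDerivAt_rpow_const (Or.inl hy.ne')) (pos₀.rpow δ).tame
  have hlev1 : ∀ z' y, lev μ (fun i => incr ℓ w (τ z' i)) mv Z₀ (k + 1) y
      = avg μ (fun z => incr ℓ w (τ z (k + 1))) (fun _ x => f₀ x ^ δ) z' y := fun z' y => by
    simp only [lev, hlev, avg, hδ]
  have main := hasDerivAt_two_level hμ hfr jδ (pos₀.rpow δ) (hT (k + 1)) (hT (k + 2)) hs
    hd₁ hσ₁ hκ₁ hd₂ hσ₂ hκ₂ hg hgt hz x
  simp only [← hlev1] at main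
  refine main.congr_deriv ?_
  rw [avg, avg, ← integral_const_mul]
  congr 1 with v
  set y := x + incr ℓ w (τ z (k + 2)) v
  have hpos := (tamePos_lev (mv := mv) hμ hT hZ (k + 1)).pos z y
  -- the derivative of level `k + 1` produced by the two-level lemma is the one of the hierarchy
  have huniq : ∀ u, avg μ (fun z => incr ℓ w (τ z (k + 1)))
      (fun _ x => (δ * f₀ x ^ (δ - 1)) • f' z x) z y u = H' z y u := fun u => by
    have h1 := (jδ.avg hμ (hT (k + 1))).hasFDerivAt z y
    have h2 := hjH.hasFDerivAt z y
    have h3 : lev μ (fun i => incr ℓ w (τ z i)) mv Z₀ (k + 1)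
        = avg μ (fun z => incr ℓ w (τ z (k + 1))) (fun _ x => f₀ x ^ δ) z := funext (hlev1 z)
    rw [← h3] at h1
    rw [h1.unique h2]
  have hw : ∀ j, H' z y (w j) = mv (k + 1) * b * lev μ (fun i => incr ℓ w (τ z i)) mv Z₀ (k + 1) y
      * ∑ i, w j i * tiltProd μ (fun i => incr ℓ w (τ z i)) mv Z₀ 1 (k + 1) (γ i) y := fun j => by
    have h1 : w j = ∑ i, w j i • Pi.single i (1 : ℝ) := by
      ext i; simp [Finset.sum_apply, Pi.single_apply]
    conv_lhs => rw [h1]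
    rw [map_sum, Finset.mul_sum]
    refine Finset.sum_congr rfl fun i _ => ?_
    rw [map_smul, smul_eq_mul, hH']
    ring
  simp only [huniq, hw, shiftForm, mul_pow]
  have h2 : lev μ (fun i => incr ℓ w (τ z i)) mv Z₀ (k + 1) y ^ α
      = lev μ (fun i => incr ℓ w (τ z i)) mv Z₀ (k + 1) y ^ (α - 2)
        * lev μ (fun i => incr ℓ w (τ z i)) mv Z₀ (k + 1) y ^ 2 := by
    rw [← rpow_natCast _ 2, ← rpow_add hpos]
    norm_num
  rw [h2, Finset.mul_sum, Finset.mul_sum, Finset.mul_sum]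
  refine Finset.sum_congr rfl fun j _ => ?_
  ring

/-- The derivative of the levels above the shift. -/
theorem hasDerivAt_lev (hμ : ExpMoments μ) (hfr : GaussianFrame μ ℓ h)
    (hs : IsOpen s) (hτ : VarianceShift τ κ (k + 1) s) (hZ : TamePos fun _ : ℝ => Z₀)
    (jZ : Jet (fun _ : ℝ => Z₀) (fun _ => Z') (fun _ => Z''))
    (hγ : ∀ i, Tame fun _ : ℝ => γ i)
    (hZγ : ∀ x i, Z' x (Pi.single i 1) = b * (Z₀ x * γ i x)) (hmv0 : mv 0 = 1)
    (hmv : ∀ k, 1 ≤ k → k ≤ r → mv k ≠ 0) (d : ℕ) (hd : k + 2 + d ≤ r) {z : ℝ} (hz : z ∈ s)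
    (x : ι → ℝ) :
    HasDerivAt (fun z => lev μ (fun i => incr ℓ w (τ z i)) mv Z₀ (k + 2 + d) x)
      (b ^ 2 / 2 * (mv (k + 2) - mv (k + 1)) * mv (k + 2 + d) *
        (lev μ (fun i => incr ℓ w (τ z i)) mv Z₀ (k + 2 + d) x
          * tiltProd μ (fun i => incr ℓ w (τ z i)) mv Z₀ (k + 2) (k + 2 + d)
            (shiftForm μ (fun i => incr ℓ w (τ z i)) mv Z₀ γ w κ (k + 1)) x)) z := by
  have hT := hτ.bddCont (ℓ := ℓ) (w := w)
  induction d generalizing z x with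
  | zero =>
    have hm1 := hmv (k + 1) (by omega) (by omega)
    set δ := mv (k + 2) / mv (k + 1) with hδ
    have main := hasDerivAt_avg_comp_lev (w := w) hμ hfr hs hτ hZ jZ hZγ hmv0 hmv
      (by omega) (g := fun y => y ^ δ) (c := δ) (α := δ)
      (fun y hy => Real.hasDerivAt_rpow_const (Or.inl hy.ne')) (fun F hF => (hF.rpow δ).tame) hz x
    refine main.congr_deriv ?_
    rw [Nat.add_zero, tiltProd_succ _ (by omega), tiltProd_of_lt _ (by omega),
      lev_mul_tilt hμ hT hZ (k + 1) _ z x, avg]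
    congr 1
    rw [hδ]
    field_simp
  | succ d ih =>
    have hmd := hmv (k + 2 + d) (by omega) (by omega)
    set q := k + 2 + d with hq
    have hV := tamePos_lev (mv := mv) hμ hT hZ q
    have hF := (tame_shiftForm (mv := mv) (ℓ := ℓ) (w := w) hμ hτ hZ hγ (k + 1)).tiltProd
      (mv := mv) hμ hT hZ (k + 2) q
    set δ := mv (q + 1) / mv q with hδ
    have main := hasDerivAt_avg_const hμ (hV.rpow δ).tame
      (((hV.rpow δ).tame.mul hF).const_mul
        (b ^ 2 / 2 * (mv (k + 2) - mv (k + 1)) * mv (q + 1))) hs (fun z hz y => by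
          refine ((ih (by omega) hz y).rpow_const (p := δ)
            (Or.inl (hV.pos z y).ne')).congr_deriv ?_
          rw [rpow_sub_one (hV.pos z y).ne', hδ]
          have := (hV.pos z y).ne'
          field_simp) (incr ℓ w (τ z (q + 1))) hz x
    have hconst : ∀ ζ, τ ζ (q + 1) = τ z (q + 1) := fun ζ =>
      hτ.const (q + 1) (by omega) (by omega) ζ z
    rw [← Nat.add_assoc, ← hq]
    simp only [lev, hconst, ← hδ]
    refine main.congr_deriv ?_
    rw [integral_const_mul, tiltProd_succ _ (by omega)]
    congr 1
    exact (lev_mul_tilt hμ hT hZ q _ z x).symm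

/-- The derivative of the averaged logarithm of the last level. -/
theorem hasDerivAt_avg_log_lev (hμ : ExpMoments μ) (hfr : GaussianFrame μ ℓ h)
    (hs : IsOpen s) (hτ : VarianceShift τ κ (k + 1) s) (hZ : TamePos fun _ : ℝ => Z₀)
    (jZ : Jet (fun _ : ℝ => Z₀) (fun _ => Z') (fun _ => Z''))
    (hγ : ∀ i, Tame fun _ : ℝ => γ i)
    (hZγ : ∀ x i, Z' x (Pi.single i 1) = b * (Z₀ x * γ i x)) (hmv0 : mv 0 = 1)
    (hmv : ∀ k, 1 ≤ k → k ≤ r → mv k ≠ 0) (hmvr : mv (r + 1) = 0) (hk : k + 1 ≤ r)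
    {z : ℝ} (hz : z ∈ s) (x : ι → ℝ) :
    HasDerivAt (fun z => avg μ (fun z => incr ℓ w (τ z (r + 1)))
        (fun z y => Real.log (lev μ (fun i => incr ℓ w (τ z i)) mv Z₀ r y)) z x)
      (b ^ 2 / 2 * (mv (k + 2) - mv (k + 1)) * mv r *
        avg μ (fun z => incr ℓ w (τ z (r + 1)))
          (fun z => tiltProd μ (fun i => incr ℓ w (τ z i)) mv Z₀ (k + 2) r
            (shiftForm μ (fun i => incr ℓ w (τ z i)) mv Z₀ γ w κ (k + 1))) z x) z := by
  have hT := hτ.bddCont (ℓ := ℓ) (w := w)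
  rcases hk.eq_or_lt with rfl | hlt
  · have main := hasDerivAt_avg_comp_lev (w := w) hμ hfr hs hτ hZ jZ hZγ hmv0 hmv
      le_rfl (g := Real.log) (c := 1) (α := 0)
      (fun y hy => by simpa [rpow_neg_one] using Real.hasDerivAt_log hy.ne')
      (fun F hF => hF.log) hz x
    refine main.congr_deriv ?_
    simp only [rpow_zero, one_mul]
    rw [hmvr]
    simp only [avg, tiltProd_of_lt _ (Nat.lt_succ_self (k + 1))]
    ring
  · obtain ⟨d, rfl⟩ : ∃ d, r = k + 2 + d := ⟨r - (k + 2), by omega⟩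
    set q := k + 2 + d with hq
    have hV := tamePos_lev (mv := mv) hμ hT hZ q
    have hF := (tame_shiftForm (mv := mv) (ℓ := ℓ) (w := w) hμ hτ hZ hγ (k + 1)).tiltProd
      (mv := mv) hμ hT hZ (k + 2) q
    have main := hasDerivAt_avg_const hμ hV.log
      (hF.const_mul (b ^ 2 / 2 * (mv (k + 2) - mv (k + 1)) * mv q)) hs (fun z hz y => by
        refine ((hasDerivAt_lev (w := w) hμ hfr hs hτ hZ jZ hγ hZγ hmv0 hmv d le_rfl hz
          y).log (hV.pos z y).ne').congr_deriv ?_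
        have := (hV.pos z y).ne'
        rw [← hq]
        field_simp) (incr ℓ w (τ z (q + 1))) hz x
    have hconst : ∀ ζ, τ ζ (q + 1) = τ z (q + 1) := fun ζ =>
      hτ.const (q + 1) (by omega) (by omega) ζ z
    simp only [avg, hconst]
    refine main.congr_deriv ?_
    rw [integral_const_mul]

/-- A continuous extension of the derivative to the closed interval is the one-sided derivative at
the endpoints. -/
theorem hasDerivWithinAt_Icc_of_continuous {F F' : ℝ → ℝ} {a c : ℝ} (hF : Continuous F)
    (hF' : Continuous F') (hd : ∀ z ∈ Set.Ioo a c, HasDerivAt F (F' z) z) (z : ℝ) :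
    HasDerivWithinAt F (F' z) (Set.Icc a c) z := by
  rcases lt_or_ge a c with hac | hca
  · rw [← closure_Ioo hac.ne]
    refine (hasFDerivWithinAt_closure_of_tendsto_fderiv
      (f' := ContinuousLinearMap.toSpanSingleton ℝ (F' z))
      (fun y hy => (hd y hy).differentiableAt.differentiableWithinAt) (convex_Ioo a c) isOpen_Ioo
      (fun y _ => hF.continuousWithinAt) ?_).hasDerivWithinAt.congr_deriv (by simp)
    have h1 : Tendsto (fun y => ContinuousLinearMap.toSpanSingleton ℝ (F' y)) (𝓝[Set.Ioo a c] z)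
        (𝓝 (ContinuousLinearMap.toSpanSingleton ℝ (F' z))) := by
      have : Continuous fun y => ContinuousLinearMap.toSpanSingleton ℝ (F' y) :=
        (ContinuousLinearMap.toSpanSingletonCLE (𝕜 := ℝ) (E := ℝ)).continuous.comp hF'
      exact this.continuousWithinAt
    refine h1.congr' ?_
    filter_upwards [self_mem_nhdsWithin] with y hy
    exact (hd y hy).hasFDerivAt.fderiv.symm
  · have h : HasFDerivWithinAt F (ContinuousLinearMap.toSpanSingleton ℝ (F' z)) (Set.Icc a c) z :=
      .of_subsingleton (Set.subsingleton_Icc_of_ge hca)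
    exact h.hasDerivWithinAt.congr_deriv (by simp)

/-- The effect of the shift after averaging over an outer Gaussian field `L`. -/
theorem hasDerivWithinAt_outer {B' : Type*} [NormedAddCommGroup B'] [NormedSpace ℝ B']
    [MeasurableSpace B'] [BorelSpace B'] [SecondCountableTopology B'] {ν : Measure B'}
    (hν : ExpMoments ν) (L : B' →L[ℝ] (ι → ℝ)) {lo hi : ℝ}
    (hμ : ExpMoments μ) (hfr : GaussianFrame μ ℓ h)
    (hτ : VarianceShift τ κ (k + 1) (Set.Ioo lo hi)) (hZ : TamePos fun _ : ℝ => Z₀)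
    (jZ : Jet (fun _ : ℝ => Z₀) (fun _ => Z') (fun _ => Z''))
    (hγ : ∀ i, Tame fun _ : ℝ => γ i)
    (hZγ : ∀ x i, Z' x (Pi.single i 1) = b * (Z₀ x * γ i x)) (hmv0 : mv 0 = 1)
    (hmv : ∀ k, 1 ≤ k → k ≤ r → mv k ≠ 0) (hmvr : mv (r + 1) = 0) (hk : k + 1 ≤ r) (z : ℝ) :
    HasDerivWithinAt (fun z => ∫ G, ∫ v, Real.log (lev μ (fun i => incr ℓ w (τ z i)) mv Z₀ r
        (L G + incr ℓ w (τ z (r + 1)) v)) ∂μ ∂ν)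
      (b ^ 2 / 2 * (mv (k + 2) - mv (k + 1)) * mv r * ∫ G, ∫ v,
        tiltProd μ (fun i => incr ℓ w (τ z i)) mv Z₀ (k + 2) r
          (shiftForm μ (fun i => incr ℓ w (τ z i)) mv Z₀ γ w κ (k + 1))
          (L G + incr ℓ w (τ z (r + 1)) v) ∂μ ∂ν) (Set.Icc lo hi) z := by
  have hT := hτ.bddCont (ℓ := ℓ) (w := w)
  have t1 := ((tamePos_lev (mv := mv) hμ hT hZ r).log.avg hμ (hT (r + 1)))
  have t2 := (((tame_shiftForm (mv := mv) (ℓ := ℓ) (w := w) hμ hτ hZ hγ (k + 1)).tiltProd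
      (mv := mv) hμ hT hZ (k + 2) r).avg hμ (hT (r + 1))).const_mul
      (b ^ 2 / 2 * (mv (k + 2) - mv (k + 1)) * mv r)
  have hL : BddCont fun _ : ℝ => L := ⟨continuous_const, ‖L‖, norm_nonneg _, fun _ => le_rfl⟩
  have c0 : Continuous fun z : ℝ => (z, (0 : ι → ℝ)) := by fun_prop
  have main := hasDerivWithinAt_Icc_of_continuous (a := lo) (c := hi)
    ((t1.avg hν hL).cont.comp c0) ((t2.avg hν hL).cont.comp c0)
    (fun z hz => hasDerivAt_avg_const hν t1 t2 isOpen_Ioo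
      (fun z hz y => hasDerivAt_avg_log_lev (w := w) hμ hfr isOpen_Ioo hτ hZ jZ hγ hZγ hmv0 hmv
        hmvr hk hz y) L hz 0) z
  simp only [Function.comp_def, avg, zero_add, integral_const_mul] at main
  exact main

end Shift

/-! ### The initial weights -/

section Base

variable {l : ℕ}

/-- The quantity `Z` as a function of the field `x i = D₀^i`. -/
def baseZ (l : ℕ) (β s : ℝ) (x : Fin l × Fin l → ℝ) : ℝ :=
  ∑ i₁, (∑ i₂, exp (β * x (i₁, i₂))) ^ s

/-- The weight `γ₀` as a function of the field. -/
def baseGamma (β s : ℝ) (i : Fin l × Fin l) (x : Fin l × Fin l → ℝ) : ℝ :=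
  (∑ i₂, exp (β * x (i.1, i₂))) ^ s / baseZ l β s x
    * (exp (β * x i) / ∑ i₂, exp (β * x (i.1, i₂)))

theorem tamePos_exp_proj {P : Type*} [TopologicalSpace P] (β : ℝ) (i : Fin l × Fin l) :
    TamePos fun (_ : P) (x : Fin l × Fin l → ℝ) => exp (β * x i) :=
  TamePos.exp_clm (β • ContinuousLinearMap.proj (R := ℝ) (φ := fun _ : Fin l × Fin l => ℝ) i)

variable [Nonempty (Fin l)] {P : Type*} [TopologicalSpace P]

theorem tamePos_sum_exp (β : ℝ) (i₁ : Fin l) :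
    TamePos fun (_ : P) (x : Fin l × Fin l → ℝ) => ∑ i₂, exp (β * x (i₁, i₂)) :=
  TamePos.sum fun i₂ => tamePos_exp_proj β (i₁, i₂)

theorem tamePos_baseZ (β s : ℝ) : TamePos fun _ : P => baseZ l β s :=
  TamePos.sum fun i₁ => (tamePos_sum_exp β i₁).rpow s

theorem tame_baseGamma (β s : ℝ) (i : Fin l × Fin l) : Tame fun _ : P => baseGamma β s i :=
  (((tamePos_sum_exp β i.1).rpow s).tame.div (tamePos_baseZ β s)).mul
    ((tamePos_exp_proj β i).tame.div (tamePos_sum_exp β i.1))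

/-- The partial derivatives of `log Z` are `β s γ₀`. -/
theorem exists_jet_baseZ (P : Type*) [TopologicalSpace P] (β s : ℝ) :
    ∃ (Z' : (Fin l × Fin l → ℝ) → (Fin l × Fin l → ℝ) →L[ℝ] ℝ)
      (Z'' : (Fin l × Fin l → ℝ) → (Fin l × Fin l → ℝ) →L[ℝ] (Fin l × Fin l → ℝ) →L[ℝ] ℝ),
      Jet (fun _ : P => baseZ l β s) (fun _ => Z') (fun _ => Z'') ∧
      ∀ x i, Z' x (Pi.single i 1) = β * s * (baseZ l β s x * baseGamma β s i x) := by
  let b : Fin l × Fin l → (Fin l × Fin l → ℝ) →L[ℝ] ℝ := fun i =>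
    β • ContinuousLinearMap.proj (R := ℝ) (φ := fun _ : Fin l × Fin l => ℝ) i
  have hb : ∀ i x, b i x = β * x i := fun i x => rfl
  have jC : ∀ i₁, Jet (fun (_ : P) (x : Fin l × Fin l → ℝ) => ∑ i₂, exp (b (i₁, i₂) x)) _ _ :=
    fun i₁ => Jet.sum fun i₂ => Jet.exp_clm (b (i₁, i₂))
  have pC : ∀ i₁, TamePos fun (_ : P) (x : Fin l × Fin l → ℝ) => ∑ i₂, exp (b (i₁, i₂) x) :=
    tamePos_sum_exp β
  have jZ := Jet.sum fun i₁ => (jC i₁).comp (pC i₁) (g := fun y => y ^ s) (c := s) (α := s)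
      (fun y hy => Real.hasDerivAt_rpow_const (Or.inl hy.ne')) ((pC i₁).rpow s).tame
  refine ⟨_, _, jZ, fun x i => ?_⟩
  have hC : 0 < ∑ i₂, exp (β * x (i.1, i₂)) := (tamePos_sum_exp (P := ℝ) β i.1).pos 0 x
  have hZ : 0 < baseZ l β s x := (tamePos_baseZ (P := ℝ) β s).pos 0 x
  simp only [_root_.sum_apply, _root_.smul_apply, smul_eq_mul, hb]
  have hin : ∑ i₂, exp (β * x (i.1, i₂)) * (β * (Pi.single i 1 : Fin l × Fin l → ℝ) (i.1, i₂))
      = exp (β * x i) * β := by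
    rw [Finset.sum_eq_single i.2]
    · simp
    · intro i₂ _ hne
      have : (i.1, i₂) ≠ i := fun h => hne (by rw [← h])
      simp [this]
    · simp
  rw [Finset.sum_eq_single i.1]
  · rw [hin, rpow_sub_one hC.ne', baseGamma]
    field_simp
  · intro i₁ _ hne
    have : ∀ i₂, (i₁, i₂) ≠ i := fun i₂ h => hne (by rw [← h])
    simp [this]
  · simp

end Base

/-! ### The blocks as Gaussian frames -/

section Block

open FullLift

variable {m n l : ℕ}

/-- The coordinates of a block, indexed by the scalar and the components of the two vectors. -/
def coord (m n : ℕ) : Unit ⊕ Fin m ⊕ Fin n → Block m n →L[ℝ] ℝ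
  | Sum.inl _ => ContinuousLinearMap.fst ℝ ℝ ((Fin m → ℝ) × (Fin n → ℝ))
  | Sum.inr (Sum.inl j) =>
    ((ContinuousLinearMap.proj (R := ℝ) (φ := fun _ : Fin m => ℝ) j).comp
      (ContinuousLinearMap.fst ℝ (Fin m → ℝ) (Fin n → ℝ))).comp
      (ContinuousLinearMap.snd ℝ ℝ ((Fin m → ℝ) × (Fin n → ℝ)))
  | Sum.inr (Sum.inr i) =>
    ((ContinuousLinearMap.proj (R := ℝ) (φ := fun _ : Fin n => ℝ) i).comp
      (ContinuousLinearMap.snd ℝ (Fin m → ℝ) (Fin n → ℝ))).comp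
      (ContinuousLinearMap.snd ℝ ℝ ((Fin m → ℝ) × (Fin n → ℝ)))

/-- The standard basis vectors of a block, dual to `coord`. -/
def coordVec (m n : ℕ) : Unit ⊕ Fin m ⊕ Fin n → Block m n
  | Sum.inl _ => (1, 0)
  | Sum.inr (Sum.inl j) => (0, (Pi.single j 1, 0))
  | Sum.inr (Sum.inr i) => (0, (0, Pi.single i 1))

instance : IsProbabilityMeasure (blockLaw m n) := by unfold blockLaw; infer_instance

instance : IsProbabilityMeasure (matrixLaw m n) := by unfold matrixLaw; infer_instance

theorem expMoments_blockLaw : ExpMoments (blockLaw m n) :=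
  expMoments_gaussianReal.prod (expMoments_gaussianReal.pi.prod expMoments_gaussianReal.pi)

theorem expMoments_matrixLaw : ExpMoments (matrixLaw m n) :=
  expMoments_gaussianReal.pi.pi

theorem gaussianFrame_blockLaw : GaussianFrame (blockLaw m n) (coord m n) (coordVec m n) := by
  have hm : ExpMoments (Measure.pi fun _ : Fin m => gaussianReal 0 1) := expMoments_gaussianReal.pi
  have hn : ExpMoments (Measure.pi fun _ : Fin n => gaussianReal 0 1) := expMoments_gaussianReal.pi
  refine ⟨fun j => ?_, fun i j => ?_⟩
  · rcases j with _ | j | i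
    · exact steinPair_gaussianReal.prod_left expMoments_gaussianReal (hm.prod hn)
    · exact ((steinPair_pi_gaussianReal j).prod_left hm hn).prod_right expMoments_gaussianReal
        (hm.prod hn)
    · exact ((steinPair_pi_gaussianReal i).prod_right hm hn).prod_right expMoments_gaussianReal
        (hm.prod hn)
  · rcases i with _ | i | i <;> rcases j with _ | j | j <;>
      simp [coord, coordVec, Pi.single_apply]

variable (x : Fin l → EuclideanSpace ℝ (Fin n)) (y : Fin l → EuclideanSpace ℝ (Fin m))

/-- The direction in field space that is excited by a coordinate of a block. -/
def dir : Unit ⊕ Fin m ⊕ Fin n → Fin l × Fin l → ℝ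
  | Sum.inl _ => fun i => ‖x i.1‖ * ‖y i.2‖
  | Sum.inr (Sum.inl j) => fun i => ‖x i.1‖ * y i.2 j
  | Sum.inr (Sum.inr j) => fun i => ‖y i.2‖ * x i.1 j

/-- The standard deviations of the coordinates of the `k`-th block. -/
def dev (p q : ℕ → ℝ) (t : ℝ) (k : ℕ) : Unit ⊕ Fin m ⊕ Fin n → ℝ
  | Sum.inl _ => √t * aCoef p q k
  | Sum.inr (Sum.inl _) => √(1 - t) * bCoef p k
  | Sum.inr (Sum.inr _) => √(1 - t) * bCoef q k

/-- The contribution of the matrix `G` to the field. -/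
def matrixField (t : ℝ) : (Fin m → Fin n → ℝ) →L[ℝ] (Fin l × Fin l → ℝ) :=
  LinearMap.toContinuousLinearMap
    { toFun := fun G i => √t * ∑ j, ∑ k, y i.2 j * G j k * x i.1 k
      map_add' := fun G G' => by
        ext i
        simp only [Pi.add_apply, mul_add, add_mul, Finset.sum_add_distrib]
      map_smul' := fun c G => by
        ext i
        simp only [Pi.smul_apply, smul_eq_mul, RingHom.id_apply, Finset.mul_sum]
        refine Finset.sum_congr rfl fun j _ => Finset.sum_congr rfl fun k _ => ?_
        ring }

variable (r : ℕ) (p q mv : ℕ → ℝ) (β s t : ℝ) (G : Fin m → Fin n → ℝ)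

/-- The increment of the field that is contributed by the `k`-th block. -/
def blockIncr (k : ℕ) : Block m n →L[ℝ] (Fin l × Fin l → ℝ) :=
  incr (coord m n) (dir x y) (dev p q t k)

/-- The part of the field that is contributed by `G` and by the blocks above `k`. -/
def fieldAbove (k : ℕ) (u : ℕ → Block m n) : Fin l × Fin l → ℝ :=
  matrixField x y t G + ∑ j ∈ Finset.Icc (k + 1) (r + 1), blockIncr x y p q t j (u j)

theorem blockIncr_apply (k : ℕ) (v : Block m n) (i : Fin l × Fin l) :
    blockIncr x y p q t k v i = √t * aCoef p q k * v.1 * (‖x i.1‖ * ‖y i.2‖)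
      + ∑ j, √(1 - t) * bCoef p k * v.2.1 j * (‖x i.1‖ * y i.2 j)
      + ∑ j, √(1 - t) * bCoef q k * v.2.2 j * (‖y i.2‖ * x i.1 j) := by
  simp [blockIncr, incr_apply, Finset.sum_apply, coord, dir, dev, add_assoc]

theorem D0_eq (i₁ i₂ : Fin l) (u : ℕ → Block m n) :
    D0 r x y p q t G i₁ i₂ u = fieldAbove x y r p q t G 0 u (i₁, i₂) := by
  simp only [D0, fieldAbove, Pi.add_apply, Finset.sum_apply, blockIncr_apply,
    Finset.sum_add_distrib, matrixField, LinearMap.coe_toContinuousLinearMap', LinearMap.coe_mk,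
    AddHom.coe_mk, zero_add, Finset.mul_sum, Finset.sum_mul]
  rw [Finset.sum_comm (s := Finset.univ) (t := Finset.Icc 1 (r + 1)),
    Finset.sum_comm (s := Finset.univ) (t := Finset.Icc 1 (r + 1))]
  have h1 : ∀ a b c d a' b' c' d' : ℝ, a = a' → b = b' → c = c' → d = d' →
      a + b + c + d = a' + (c' + b' + d') := by
    rintro a b c d _ _ _ _ rfl rfl rfl rfl; ring
  refine h1 _ _ _ _ _ _ _ _ rfl ?_ ?_ ?_
  · exact Finset.sum_congr rfl fun k _ => Finset.sum_congr rfl fun j _ => by ring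
  · exact Finset.sum_congr rfl fun k _ => by ring
  · exact Finset.sum_congr rfl fun k _ => Finset.sum_congr rfl fun j _ => by ring

theorem fieldAbove_succ_update (k : ℕ) (u : ℕ → Block m n) (v : Block m n) :
    fieldAbove x y r p q t G (k + 1) (Function.update u (k + 1) v)
      = fieldAbove x y r p q t G (k + 1) u := by
  unfold fieldAbove
  congr 1
  refine Finset.sum_congr rfl fun j hj => ?_
  rw [Finset.mem_Icc] at hj
  rw [Function.update_of_ne (by omega)]

/-- Resampling the block `k + 1` splits the field into the part above `k + 1` and a fresh increment;
this turns expectations over a block into averages over increments of the field. -/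
theorem fieldAbove_update (k : ℕ) (hk : k ≤ r) (u : ℕ → Block m n) (v : Block m n) :
    fieldAbove x y r p q t G k (Function.update u (k + 1) v)
      = fieldAbove x y r p q t G (k + 1) u + blockIncr x y p q t (k + 1) v := by
  rw [← fieldAbove_succ_update x y r p q t G k u v]
  unfold fieldAbove
  rw [← Finset.add_sum_Ioc_eq_sum_Icc (by omega : k + 1 ≤ r + 1), Function.update_self,
    ← Finset.Icc_succ_left_eq_Ioc]
  simp only [Order.succ_eq_add_one]
  abel

theorem fieldAbove_last (v : Block m n) :
    fieldAbove x y r p q t G r (Function.update 0 (r + 1) v)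
      = matrixField x y t G + blockIncr x y p q t (r + 1) v := by
  simp [fieldAbove]

/-- The levels of the hierarchy for the field of the theorem. -/
abbrev fieldLev (k : ℕ) : (Fin l × Fin l → ℝ) → ℝ :=
  lev (blockLaw m n) (blockIncr x y p q t) mv (baseZ l β s) k

/-- The composed tilted averages for the field of the theorem. -/
abbrev fieldTilt (lo hi : ℕ) : ((Fin l × Fin l → ℝ) → ℝ) → (Fin l × Fin l → ℝ) → ℝ :=
  tiltProd (blockLaw m n) (blockIncr x y p q t) mv (baseZ l β s) lo hi

theorem zeta_eq (k : ℕ) (hk : k ≤ r + 1) (u : ℕ → Block m n) :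
    zeta r x y p q mv β s t G k u
      = fieldLev x y p q mv β s t k (fieldAbove x y r p q t G k u) := by
  induction k generalizing u with
  | zero => simp only [zeta, FullLift.Z, FullLift.C, FullLift.A, D0_eq, lev, baseZ]
  | succ k ih =>
    simp only [zeta, expBlock, lev]
    congr 1 with v
    rw [ih (by omega), fieldAbove_update x y r p q t G k (by omega)]

theorem Phi_eq (k : ℕ) (hk : k ≤ r) {F : (ℕ → Block m n) → ℝ} {f : (Fin l × Fin l → ℝ) → ℝ}
    (hF : ∀ u, F u = f (fieldAbove x y r p q t G k u)) (u : ℕ → Block m n) :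
    Phi r x y p q mv β s t G (k + 1) F u
      = tilt (blockLaw m n) (blockIncr x y p q t) mv (baseZ l β s) (k + 1) f
        (fieldAbove x y r p q t G (k + 1) u) := by
  simp only [Phi, expBlock, tilt, Nat.add_sub_cancel]
  congr 1 with v
  rw [zeta_eq _ _ _ _ _ _ _ _ _ _ k (by omega), zeta_eq _ _ _ _ _ _ _ _ _ _ (k + 1) (by omega),
    hF, fieldAbove_succ_update, fieldAbove_update x y r p q t G k hk]

theorem PhiProd_eq (a d : ℕ) (h : a + d ≤ r + 1) {F : (ℕ → Block m n) → ℝ}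
    {f : (Fin l × Fin l → ℝ) → ℝ} (hF : ∀ u, F u = f (fieldAbove x y r p q t G a u))
    (u : ℕ → Block m n) :
    PhiProd r x y p q mv β s t G (a + 1) (a + d) F u
      = fieldTilt x y p q mv β s t (a + 1) (a + d) f (fieldAbove x y r p q t G (a + d) u) := by
  induction d generalizing u with
  | zero =>
    rw [fieldTilt, tiltProd_of_lt _ (by omega)]
    rcases a with _ | a
    · exact hF u
    · simpa [PhiProd] using hF u
  | succ d ih =>
    rw [← Nat.add_assoc, PhiProd, if_pos (by omega), fieldTilt, tiltProd_succ _ (by omega)]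
    exact Phi_eq x y r p q mv β s t G (a + d) (by omega) (ih (by omega)) u

/-- The weights `γ_{k+1}` as functions of the field. -/
def fieldGamma (k : ℕ) (i i' : Fin l × Fin l) : (Fin l × Fin l → ℝ) → ℝ :=
  fieldTilt x y p q mv β s t (k + 1) r fun f =>
    fieldTilt x y p q mv β s t 1 k (baseGamma β s i) f
      * fieldTilt x y p q mv β s t 1 k (baseGamma β s i') f

theorem gamma_eq (k : ℕ) (hk : k ≤ r) (i₁ i₂ p₁ p₂ : Fin l) (u : ℕ → Block m n) :
    gamma r x y p q mv β s t G k i₁ i₂ p₁ p₂ u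
      = fieldGamma x y r p q mv β s t k (i₁, i₂) (p₁, p₂) (fieldAbove x y r p q t G r u) := by
  obtain ⟨d, rfl⟩ := Nat.exists_eq_add_of_le hk
  have h0 : ∀ i₁ i₂ u, gamma0 (k + d) x y p q β s t G i₁ i₂ u
      = baseGamma β s (i₁, i₂) (fieldAbove x y (k + d) p q t G 0 u) := fun i₁ i₂ u => by
    simp only [gamma0, FullLift.Z, FullLift.C, FullLift.A, D0_eq, baseGamma, baseZ]
  have h1 : ∀ i₁ i₂ u, PhiProd (k + d) x y p q mv β s t G 1 k
      (gamma0 (k + d) x y p q β s t G i₁ i₂) u = fieldTilt x y p q mv β s t 1 k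
      (baseGamma β s (i₁, i₂)) (fieldAbove x y (k + d) p q t G k u) := fun i₁ i₂ u => by
    have := PhiProd_eq x y (k + d) p q mv β s t G 0 k (by omega) (h0 i₁ i₂) u
    simpa only [Nat.zero_add] using this
  exact PhiProd_eq x y (k + d) p q mv β s t G k d (by omega)
    (fun u => by rw [h1, h1]) u

theorem bddCont_const {F : Type*} [NormedAddCommGroup F] (T : F) : BddCont fun _ : ℝ => T :=
  ⟨continuous_const, ‖T‖, norm_nonneg _, fun _ => le_rfl⟩

/-- The outer expectation of a tame function of the field is an iterated integral. -/
theorem expOuter_eq {f : (Fin l × Fin l → ℝ) → ℝ} (hf : Tame fun _ : ℝ => f) :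
    expOuter r (fun (G : Fin m → Fin n → ℝ) u => f (fieldAbove x y r p q t G r u))
      = ∫ G, ∫ v, f (matrixField x y t G + blockIncr x y p q t (r + 1) v)
          ∂(blockLaw m n) ∂(matrixLaw m n) := by
  simp only [expOuter, fieldAbove_last]
  refine integral_prod (fun w : (Fin m → Fin n → ℝ) × Block m n =>
    f (matrixField x y t w.1 + blockIncr x y p q t (r + 1) w.2)) ?_
  have h := hf.integrable_shift (expMoments_matrixLaw (m := m) (n := n) |>.prod
    (expMoments_blockLaw (m := m) (n := n))) 0 0
    ((matrixField x y t).comp (ContinuousLinearMap.fst ℝ _ _)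
      + (blockIncr x y p q t (r + 1)).comp (ContinuousLinearMap.snd ℝ _ _))
  simpa using h

theorem integral_field_sum {ι : Type*} [Fintype ι] (c : ι → ℝ)
    {f : ι → (Fin l × Fin l → ℝ) → ℝ} (hf : ∀ i, Tame fun _ : ℝ => f i) :
    ∫ G, ∫ v, ∑ i, c i * f i (matrixField x y t G + blockIncr x y p q t (r + 1) v)
        ∂(blockLaw m n) ∂(matrixLaw m n)
      = ∑ i, c i * ∫ G, ∫ v, f i (matrixField x y t G + blockIncr x y p q t (r + 1) v)
        ∂(blockLaw m n) ∂(matrixLaw m n) := by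
  have h1 : ∀ G : Fin m → Fin n → ℝ,
      ∫ v, ∑ i, c i * f i (matrixField x y t G + blockIncr x y p q t (r + 1) v) ∂(blockLaw m n)
      = ∑ i, c i * ∫ v, f i (matrixField x y t G + blockIncr x y p q t (r + 1) v)
        ∂(blockLaw m n) := fun G => by
    rw [integral_finsetSum _ fun i _ =>
      ((hf i).integrable_shift expMoments_blockLaw 0 _ _).const_mul _]
    exact Finset.sum_congr rfl fun i _ => integral_const_mul _ _
  simp only [h1]
  rw [integral_finsetSum]
  · exact Finset.sum_congr rfl fun i _ => integral_const_mul _ _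
  · intro i _
    have h2 := ((hf i).avg (expMoments_blockLaw (m := m) (n := n))
      (bddCont_const (blockIncr x y p q t (r + 1)))).integrable_shift
      (expMoments_matrixLaw (m := m) (n := n)) 0 0 (matrixField x y t)
    simp only [avg, zero_add] at h2
    exact h2.const_mul _

variable [Nonempty (Fin l)]

theorem tame_fieldGamma (k : ℕ) (i i' : Fin l × Fin l) :
    Tame fun _ : ℝ => fieldGamma x y r p q mv β s t k i i' := by
  have hT : ∀ k, BddCont fun _ : ℝ => blockIncr x y p q t k := fun k => bddCont_const _
  have h := fun i => (tame_baseGamma (P := ℝ) β s i).tiltProd (mv := mv)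
    (expMoments_blockLaw (m := m) (n := n)) hT (tamePos_baseZ (l := l) β s) 1 k
  exact ((h i).mul (h i')).tiltProd (mv := mv)
    (expMoments_blockLaw (m := m) (n := n)) hT (tamePos_baseZ (l := l) β s) (k + 1) r

/-- The Gaussian average of the weight `fieldGamma`. -/
def meanGamma (k : ℕ) (i i' : Fin l × Fin l) : ℝ :=
  ∫ G, ∫ v, fieldGamma x y r p q mv β s t k i i'
    (matrixField x y t G + blockIncr x y p q t (r + 1) v) ∂(blockLaw m n) ∂(matrixLaw m n)

theorem gammaAvg_eq (k : ℕ) (hk : k ≤ r) (F : Fin l → Fin l → Fin l → Fin l → ℝ) :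
    gammaAvg r x y p q mv β s t k F
      = ∑ a : (Fin l × Fin l) × (Fin l × Fin l), F a.1.1 a.1.2 a.2.1 a.2.2
          * meanGamma x y r p q mv β s t k a.1 a.2 := by
  have h1 : ∀ (G : Fin m → Fin n → ℝ) (u : ℕ → Block m n),
      (∑ i₁, ∑ i₂, ∑ p₁, ∑ p₂, gamma r x y p q mv β s t G k i₁ i₂ p₁ p₂ u * F i₁ i₂ p₁ p₂)
      = (fun f => ∑ a : (Fin l × Fin l) × (Fin l × Fin l), F a.1.1 a.1.2 a.2.1 a.2.2
          * fieldGamma x y r p q mv β s t k a.1 a.2 f) (fieldAbove x y r p q t G r u) :=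
    fun G u => by
      simp only [gamma_eq x y r p q mv β s t G k hk, Fintype.sum_prod_type, mul_comm]
  have hf : Tame fun _ : ℝ => fun f => ∑ a : (Fin l × Fin l) × (Fin l × Fin l),
      F a.1.1 a.1.2 a.2.1 a.2.2 * fieldGamma x y r p q mv β s t k a.1 a.2 f :=
    Tame.sum _ fun a _ => (tame_fieldGamma x y r p q mv β s t k a.1 a.2).const_mul _
  unfold gammaAvg
  simp only [h1]
  rw [expOuter_eq x y r p q t hf]
  exact integral_field_sum x y r p q t _ fun a => tame_fieldGamma x y r p q mv β s t k a.1 a.2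

theorem psi_eq :
    psi r x y p q mv β s t = 1 / (β * |s| * √(n : ℝ) * mv r) *
      ∫ G, ∫ v, Real.log (fieldLev x y p q mv β s t r
        (matrixField x y t G + blockIncr x y p q t (r + 1) v))
        ∂(blockLaw m n) ∂(matrixLaw m n) := by
  have hT : ∀ k, BddCont fun _ : ℝ => blockIncr x y p q t k := fun k => bddCont_const _
  have hf := (tamePos_lev (mv := mv) (expMoments_blockLaw (m := m) (n := n)) hT
    (tamePos_baseZ (l := l) β s) r).log.const_mul (1 / (β * |s| * √(n : ℝ) * mv r))
  have h := expOuter_eq x y r p q t hf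
  unfold psi
  simp only [zeta_eq x y r p q mv β s t _ r (Nat.le_succ r)]
  rw [h]
  simp only [integral_const_mul]

end Block

/-! ### Varying one overlap parameter -/

section Clamp

variable {lo hi : ℝ}

/-- The projection of `z` to the interval `[lo, hi]`. -/
def clamp (lo hi z : ℝ) : ℝ := max lo (min hi z)

theorem continuous_clamp : Continuous (clamp lo hi) := by unfold clamp; fun_prop

theorem clamp_mem (h : lo ≤ hi) (z : ℝ) : clamp lo hi z ∈ Set.Icc lo hi :=
  ⟨le_max_left _ _, max_le h (min_le_left _ _)⟩

theorem clamp_of_mem {z : ℝ} (hz : z ∈ Set.Icc lo hi) : clamp lo hi z = z := by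
  rw [clamp, min_eq_right hz.2, max_eq_right hz.1]

/-- An affine function that is nonnegative on an interval is positive in the interior unless it is
constant, so its square root is differentiable there. -/
theorem exists_deriv_sqrt_clamp {A c : ℝ} (h : lo ≤ hi)
    (hnn : ∀ z ∈ Set.Icc lo hi, 0 ≤ A + c * z) :
    ∃ σ : ℝ → ℝ, (∀ z ∈ Set.Ioo lo hi, HasDerivAt (fun z => √(A + c * clamp lo hi z)) (σ z) z) ∧
      ContinuousOn σ (Set.Ioo lo hi) ∧
      ∀ z ∈ Set.Ioo lo hi, σ z * √(A + c * clamp lo hi z) = c / 2 := by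
  rcases eq_or_ne c 0 with rfl | hc
  · refine ⟨fun _ => 0, fun z _ => ?_, continuousOn_const, fun z _ => by simp⟩
    simpa using hasDerivAt_const z (√A)
  · have hpos : ∀ z ∈ Set.Ioo lo hi, 0 < A + c * z := fun z hz => by
      have h1 := hnn lo ⟨le_rfl, h⟩
      have h2 := hnn hi ⟨h, le_rfl⟩
      rcases lt_or_gt_of_ne hc with hc | hc
      · nlinarith [mul_pos_of_neg_of_neg hc (sub_neg.2 hz.2)]
      · nlinarith [mul_pos hc (sub_pos.2 hz.1)]
    refine ⟨fun z => c / (2 * √(A + c * z)), fun z hz => ?_, ?_, fun z hz => ?_⟩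
    · have h1 : HasDerivAt (fun z => A + c * z) c z := by
        simpa using ((hasDerivAt_id z).const_mul c).const_add A
      refine (h1.sqrt (hpos z hz).ne').congr_of_eventuallyEq ?_
      filter_upwards [isOpen_Ioo.mem_nhds hz] with ζ hζ
      rw [clamp_of_mem ⟨hζ.1.le, hζ.2.le⟩]
    · refine ContinuousOn.div continuousOn_const (by fun_prop) fun z hz => ?_
      have := Real.sqrt_pos.2 (hpos z hz)
      positivity
    · rw [clamp_of_mem ⟨hz.1.le, hz.2.le⟩]
      have := (Real.sqrt_pos.2 (hpos z hz)).ne'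
      field_simp

/-- Variances that are affine in `z`, with opposite slopes at the levels `k` and `k + 1`, form a
shift of variance. -/
theorem varianceShift_of_sqrt {J : Type*} {τ : ℝ → ℕ → J → ℝ} {κ : J → ℝ} {k : ℕ} (h : lo ≤ hi)
    (hconst : ∀ i, i ≠ k → i ≠ k + 1 → ∀ z z', τ z i = τ z' i) {A A' : J → ℝ}
    (hl : ∀ z j, τ z k j = √(A j + -κ j * clamp lo hi z))
    (hl0 : ∀ j, ∀ z ∈ Set.Icc lo hi, 0 ≤ A j + -κ j * z)
    (hu : ∀ z j, τ z (k + 1) j = √(A' j + κ j * clamp lo hi z))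
    (hu0 : ∀ j, ∀ z ∈ Set.Icc lo hi, 0 ≤ A' j + κ j * z) :
    VarianceShift τ κ k (Set.Ioo lo hi) := by
  have hc : ∀ A c : ℝ, Continuous fun z => √(A + c * clamp lo hi z) := fun A c => by
    have := continuous_clamp (lo := lo) (hi := hi)
    fun_prop
  have hb : ∀ A c : ℝ, ∃ R, ∀ z, |√(A + c * clamp lo hi z)| ≤ R := fun A c => by
    obtain ⟨R, hR⟩ := (isCompact_Icc (a := lo) (b := hi)).exists_bound_of_continuousOn
      (f := fun z => √(A + c * z)) (by fun_prop)
    exact ⟨R, fun z => hR _ (clamp_mem h z)⟩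
  refine ⟨fun i j => ?_, fun i j => ?_, hconst, ?_, ?_⟩
  · by_cases h1 : i = k
    · subst h1; simp only [hl]; exact hc _ _
    by_cases h2 : i = k + 1
    · subst h2; simp only [hu]; exact hc _ _
    have : (fun z => τ z i j) = fun _ => τ 0 i j := by
      ext z; rw [hconst i h1 h2 z 0]
    rw [this]; exact continuous_const
  · by_cases h1 : i = k
    · subst h1; simp only [hl]; exact hb _ _
    by_cases h2 : i = k + 1
    · subst h2; simp only [hu]; exact hb _ _
    exact ⟨|τ 0 i j|, fun z => by rw [hconst i h1 h2 z 0]⟩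
  · choose σ h1 h2 h3 using fun j => exists_deriv_sqrt_clamp h (hl0 j)
    refine ⟨fun z j => σ j z, fun z hz j => ?_, h2, fun z hz j => ?_⟩
    · simp only [hl]; exact h1 j z hz
    · rw [hl, h3 j z hz, neg_div]
  · choose σ h1 h2 h3 using fun j => exists_deriv_sqrt_clamp h (hu0 j)
    refine ⟨fun z j => σ j z, fun z hz j => ?_, h2, fun z hz j => ?_⟩
    · simp only [hu]; exact h1 j z hz
    · rw [hu, h3 j z hz]

end Clamp

/-! ### The derivatives of `ψ` -/

section Final

open FullLift

variable {m n l : ℕ} {r k : ℕ} {x : Fin l → EuclideanSpace ℝ (Fin n)}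
  {y : Fin l → EuclideanSpace ℝ (Fin m)} {mv : ℕ → ℝ} {β s t lo hi : ℝ}

theorem sum_mul_sum_sq {J ι : Type*} [Fintype J] [Fintype ι] (κ : J → ℝ) (w : J → ι → ℝ)
    (a : ι → ℝ) : ∑ j, κ j * (∑ i, w j i * a i) ^ 2
      = ∑ i : ι × ι, (∑ j, κ j * (w j i.1 * w j i.2)) * (a i.1 * a i.2) := by
  simp only [sq, Finset.mul_sum, Finset.sum_mul, Fintype.sum_prod_type]
  rw [Finset.sum_comm]
  refine Finset.sum_congr rfl fun i _ => ?_
  rw [Finset.sum_comm]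
  exact Finset.sum_congr rfl fun i' _ => Finset.sum_congr rfl fun j _ => by ring

/-- For `β = 0`, `s = 0` or `n = 0` both sides vanish, as division by zero gives zero. -/
theorem prefactor_eq (n : ℕ) (β s : ℝ) {M M₁ M₂ : ℝ} (hM : M ≠ 0) :
    1 / (β * |s| * √(n : ℝ) * M) * ((β * s) ^ 2 / 2 * (M₂ - M₁) * M)
      = Real.sign s * s * β / (2 * √(n : ℝ)) * -(M₁ - M₂) := by
  have hsgn : Real.sign s * s = |s| := by
    rcases lt_trichotomy s 0 with h | rfl | h
    · rw [Real.sign_of_neg h, abs_of_neg h]; ring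
    · simp
    · rw [Real.sign_of_pos h, abs_of_pos h]; ring
  rw [hsgn]
  rcases eq_or_ne β 0 with rfl | hβ
  · simp
  rcases eq_or_ne s 0 with rfl | hs
  · simp
  rcases eq_or_ne √(n : ℝ) 0 with hn | hn
  · simp [hn]
  have habs : |s| ≠ 0 := abs_ne_zero.2 hs
  rw [mul_pow, ← sq_abs s]
  field_simp
  ring

/-- The derivative of `ψ` along any path of overlap parameters that moves variance from block
`k + 1` to block `k + 2`. -/
theorem hasDerivWithinAt_psi [Nonempty (Fin l)] {pz qz : ℝ → ℕ → ℝ}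
    {κ : Unit ⊕ Fin m ⊕ Fin n → ℝ}
    (hτ : VarianceShift (fun z i => dev (pz z) (qz z) t i) κ (k + 1) (Set.Ioo lo hi))
    (hmv0 : mv 0 = 1) (hmv : ∀ k, 1 ≤ k → k ≤ r → mv k ≠ 0) (hmvr : mv (r + 1) = 0)
    (hk : k + 1 ≤ r) (z : ℝ) :
    HasDerivWithinAt (fun z => psi r x y (pz z) (qz z) mv β s t)
      (Real.sign s * s * β / (2 * √(n : ℝ)) * (-(mv (k + 1) - mv (k + 2)) *
        gammaAvg r x y (pz z) (qz z) mv β s t (k + 1) fun i₁ i₂ p₁ p₂ =>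
          ∑ j, κ j * (dir x y j (i₁, i₂) * dir x y j (p₁, p₂))))
      (Set.Icc lo hi) z := by
  obtain ⟨Z', Z'', jZ, hZγ⟩ := exists_jet_baseZ (l := l) ℝ β s
  have hγ : ∀ i, Tame fun _ : ℝ => baseGamma β s i := fun i => tame_baseGamma (l := l) β s i
  have main := (hasDerivWithinAt_outer (w := dir x y) expMoments_matrixLaw (matrixField x y t)
    expMoments_blockLaw gaussianFrame_blockLaw hτ (tamePos_baseZ β s) jZ hγ hZγ
    hmv0 hmv hmvr hk z).const_mul (1 / (β * |s| * √(n : ℝ) * mv r))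
  have hpsi : (fun z => psi r x y (pz z) (qz z) mv β s t) = _ := funext fun z =>
    psi_eq x y r (pz z) (qz z) mv β s t
  rw [hpsi]
  refine main.congr_deriv ?_
  rw [gammaAvg_eq x y r (pz z) (qz z) mv β s t (k + 1) hk]
  -- expand the quadratic form, and use that the tilted averages are linear
  have hT : ∀ k, BddCont fun _ : ℝ => blockIncr x y (pz z) (qz z) t k := fun k => bddCont_const _
  have hlin : tiltProd (blockLaw m n) (blockIncr x y (pz z) (qz z) t) mv (baseZ l β s) (k + 2) r
      (shiftForm (blockLaw m n) (blockIncr x y (pz z) (qz z) t) mv (baseZ l β s)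
        (baseGamma β s) (dir x y) κ (k + 1))
      = fun f => ∑ a : (Fin l × Fin l) × (Fin l × Fin l),
        (∑ j, κ j * (dir x y j a.1 * dir x y j a.2)) *
          fieldGamma x y r (pz z) (qz z) mv β s t (k + 1) a.1 a.2 f := by
    rw [show shiftForm (blockLaw m n) (blockIncr x y (pz z) (qz z) t) mv (baseZ l β s)
        (baseGamma β s) (dir x y) κ (k + 1) = _ from funext fun f => sum_mul_sum_sq κ _ _]
    have h := fun i => (hγ i).tiltProd (mv := mv)
      (expMoments_blockLaw (m := m) (n := n)) hT (tamePos_baseZ (l := l) β s) 1 (k + 1)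
    exact tiltProd_sum (expMoments_blockLaw (m := m) (n := n)) hT (tamePos_baseZ (l := l) β s)
      (k + 2) r _ (fun a : (Fin l × Fin l) × (Fin l × Fin l) => (h a.1).mul (h a.2)) z
  have hint := integral_field_sum x y r (pz z) (qz z) t
    (fun a : (Fin l × Fin l) × (Fin l × Fin l) => ∑ j, κ j * (dir x y j a.1 * dir x y j a.2))
    fun a => tame_fieldGamma x y r (pz z) (qz z) mv β s t (k + 1) a.1 a.2
  rw [show (fun i => incr (coord m n) (dir x y) (dev (pz z) (qz z) t i))
    = blockIncr x y (pz z) (qz z) t from rfl, hlin]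
  simp only [blockIncr] at hint ⊢
  rw [hint]
  refine (mul_assoc _ _ _).symm.trans ?_
  rw [prefactor_eq n β s (hmv r (by omega) le_rfl), mul_assoc]
  rfl

/-- Without any points, `Z = 0`, and `ψ` does not depend on the overlap parameters. -/
theorem psi_eq_of_isEmpty [IsEmpty (Fin l)] (p q p' q' : ℕ → ℝ) :
    psi r x y p q mv β s t = psi r x y p' q' mv β s t := by
  have h : ∀ (G : Fin m → Fin n → ℝ) k, zeta r x y p q mv β s t G k
      = zeta r x y p' q' mv β s t G k := fun G k => by
    induction k with
    | zero => ext u; simp [zeta, FullLift.Z]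
    | succ k ih => simp only [zeta, ih]
  simp only [psi, h]

theorem gammaAvg_of_isEmpty [IsEmpty (Fin l)] (p q : ℕ → ℝ) (k : ℕ)
    (F : Fin l → Fin l → Fin l → Fin l → ℝ) : gammaAvg r x y p q mv β s t k F = 0 := by
  simp [gammaAvg, expOuter]

theorem gammaAvg_add_mul [Nonempty (Fin l)] (p q : ℕ → ℝ) (hk : k ≤ r) (c₁ c₂ : ℝ)
    (F₁ F₂ : Fin l → Fin l → Fin l → Fin l → ℝ) :
    gammaAvg r x y p q mv β s t k
        (fun i₁ i₂ p₁ p₂ => c₁ * F₁ i₁ i₂ p₁ p₂ + c₂ * F₂ i₁ i₂ p₁ p₂)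
      = c₁ * gammaAvg r x y p q mv β s t k F₁ + c₂ * gammaAvg r x y p q mv β s t k F₂ := by
  simp only [gammaAvg_eq x y r p q mv β s t k hk, Finset.mul_sum, ← Finset.sum_add_distrib]
  exact Finset.sum_congr rfl fun a _ => by ring

theorem mem_Icc_of_anti {p : ℕ → ℝ} (hp : ∀ k, k ≤ r → p (k + 1) ≤ p k) (hk : k + 1 ≤ r) :
    p (k + 1) ∈ Set.Icc (p (k + 2)) (p k) :=
  ⟨hp (k + 1) hk, hp k (by omega)⟩

theorem nonneg_of_anti {p : ℕ → ℝ} (hp : ∀ k, k ≤ r → p (k + 1) ≤ p k) (h0 : p (r + 1) = 0)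
    (k : ℕ) (hk : k ≤ r + 1) : 0 ≤ p k := by
  induction hk using Nat.decreasingInduction with
  | of_succ k hk ih => exact ih.trans (hp k (by omega))
  | self => exact h0.ge

/-- The rates at which variance is moved from block `k` to block `k + 1` when `p k` increases. -/
def rateP (m n : ℕ) (q : ℕ → ℝ) (t : ℝ) (k : ℕ) : Unit ⊕ Fin m ⊕ Fin n → ℝ
  | Sum.inl _ => t * q k
  | Sum.inr (Sum.inl _) => 1 - t
  | Sum.inr (Sum.inr _) => 0

/-- The rates at which variance is moved from block `k` to block `k + 1` when `q k` increases. -/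
def rateQ (m n : ℕ) (p : ℕ → ℝ) (t : ℝ) (k : ℕ) : Unit ⊕ Fin m ⊕ Fin n → ℝ
  | Sum.inl _ => t * p k
  | Sum.inr (Sum.inl _) => 0
  | Sum.inr (Sum.inr _) => 1 - t

theorem varianceShift_p {p q : ℕ → ℝ} (ht : t ∈ Set.Icc (0 : ℝ) 1)
    (hp : ∀ k, k ≤ r → p (k + 1) ≤ p k) (hp0 : p (r + 1) = 0)
    (hq : ∀ k, k ≤ r → q (k + 1) ≤ q k) (hq0 : q (r + 1) = 0) (hk : k + 1 ≤ r) :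
    VarianceShift (fun z i => dev (m := m) (n := n)
        (Function.update p (k + 1) (clamp (p (k + 2)) (p k) z)) q t i)
      (rateP m n q t (k + 1)) (k + 1) (Set.Ioo (p (k + 2)) (p k)) := by
  have ht0 := ht.1
  have ht1 : 0 ≤ 1 - t := by linarith [ht.2]
  have hmem := mem_Icc_of_anti hp hk
  have hq1 := nonneg_of_anti hq hq0 (k + 1) (by omega)
  have hq2 := nonneg_of_anti hq hq0 (k + 2) (by omega)
  have hp2 := nonneg_of_anti hp hp0 (k + 2) (by omega)
  have hqk := hq k (by omega)
  have hqk1 := hq (k + 1) (by omega)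
  have e1 : k + 1 - 1 = k := rfl
  have e2 : k + 1 + 1 - 1 = k + 1 := rfl
  have e3 : k ≠ k + 1 := by omega
  have e4 : k + 1 + 1 ≠ k + 1 := by omega
  refine varianceShift_of_sqrt (hmem.1.trans hmem.2) (fun i h1 h2 z z' => ?_)
    (A := fun
      | Sum.inl _ => t * (p k * q k)
      | Sum.inr (Sum.inl _) => (1 - t) * p k
      | Sum.inr (Sum.inr _) => (1 - t) * (q k - q (k + 1)))
    (A' := fun
      | Sum.inl _ => -(t * (p (k + 2) * q (k + 2)))
      | Sum.inr (Sum.inl _) => -((1 - t) * p (k + 2))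
      | Sum.inr (Sum.inr _) => (1 - t) * (q (k + 1) - q (k + 2))) ?_ ?_ ?_ ?_
  · have h3 : i - 1 ≠ k + 1 := by omega
    funext j
    rcases j with _ | j | j <;> simp [dev, aCoef, bCoef, h1, h3]
  · rintro z (_ | j | j) <;> simp only [dev, aCoef, bCoef, rateP, e1,
      Function.update_self, Function.update_of_ne e3]
    · rw [← Real.sqrt_mul ht0]; congr 1; ring
    · rw [← Real.sqrt_mul ht1]; congr 1; ring
    · rw [← Real.sqrt_mul ht1]; congr 1; ring
  · rintro (_ | j | j) z hz <;> simp only [rateP]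
    · have : z * q (k + 1) ≤ p k * q k := by nlinarith [hz.2, hz.1]
      nlinarith
    · nlinarith [hz.2]
    · nlinarith
  · rintro z (_ | j | j) <;> simp only [dev, aCoef, bCoef, rateP, e2,
      Function.update_self, Function.update_of_ne e4]
    · rw [← Real.sqrt_mul ht0]; congr 1; ring
    · rw [← Real.sqrt_mul ht1]; congr 1; ring
    · rw [← Real.sqrt_mul ht1]; congr 1; ring
  · rintro (_ | j | j) z hz <;> simp only [rateP]
    · have : p (k + 2) * q (k + 2) ≤ z * q (k + 1) := by nlinarith [hz.2, hz.1]
      nlinarith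
    · nlinarith [hz.1]
    · nlinarith

theorem aCoef_comm (p q : ℕ → ℝ) (i : ℕ) : aCoef p q i = aCoef q p i := by
  simp only [aCoef, mul_comm]

theorem varianceShift_q {p q : ℕ → ℝ} (ht : t ∈ Set.Icc (0 : ℝ) 1)
    (hp : ∀ k, k ≤ r → p (k + 1) ≤ p k) (hp0 : p (r + 1) = 0)
    (hq : ∀ k, k ≤ r → q (k + 1) ≤ q k) (hq0 : q (r + 1) = 0) (hk : k + 1 ≤ r) :
    VarianceShift (fun z i => dev (m := m) (n := n) p
        (Function.update q (k + 1) (clamp (q (k + 2)) (q k) z)) t i)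
      (rateQ m n p t (k + 1)) (k + 1) (Set.Ioo (q (k + 2)) (q k)) := by
  -- exchanging `p` and `q` only exchanges the roles of the two vectors of a block
  have h := varianceShift_p (m := n) (n := m) ht hq hq0 hp hp0 hk
  let e : Unit ⊕ Fin m ⊕ Fin n → Unit ⊕ Fin n ⊕ Fin m := Sum.map id Sum.swap
  have hdev : ∀ (p q : ℕ → ℝ) i j, dev (m := m) (n := n) p q t i j = dev q p t i (e j) := by
    rintro p q i (_ | j | j) <;> simp [dev, e, aCoef_comm p q]
  have hrate : ∀ j, rateQ m n p t (k + 1) j = rateP n m p t (k + 1) (e j) := by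
    rintro (_ | j | j) <;> simp [rateQ, rateP, e]
  obtain ⟨σ, a1, a2, a3⟩ := h.deriv_lower
  obtain ⟨σ', b1, b2, b3⟩ := h.deriv_upper
  refine ⟨fun i j => ?_, fun i j => ?_, fun i h1 h2 z z' => ?_,
    ⟨fun z j => σ z (e j), fun z hz j => ?_, fun j => a2 (e j), fun z hz j => ?_⟩,
    ⟨fun z j => σ' z (e j), fun z hz j => ?_, fun j => b2 (e j), fun z hz j => ?_⟩⟩
  · simp only [hdev]; exact h.cont i (e j)
  · simp only [hdev]; exact h.bdd i (e j)
  · funext j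
    simp only [hdev]
    exact congrFun (h.const i h1 h2 z z') (e j)
  · simp only [hdev]; exact a1 z hz (e j)
  · simp only [hdev, hrate]; exact a3 z hz (e j)
  · simp only [hdev]; exact b1 z hz (e j)
  · simp only [hdev, hrate]; exact b3 z hz (e j)

theorem sum_rateP_dir (q : ℕ → ℝ) (i₁ i₂ p₁ p₂ : Fin l) :
    ∑ j, rateP m n q t k j * (dir x y j (i₁, i₂) * dir x y j (p₁, p₂))
      = (1 - t) * (‖x i₁‖ * ‖x p₁‖ * inner ℝ (y p₂) (y i₂))
        + t * q k * (‖x i₁‖ * ‖x p₁‖ * ‖y i₂‖ * ‖y p₂‖) := by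
  simp only [Fintype.sum_sum_type, rateP, dir, PiLp.inner_apply, RCLike.inner_apply, conj_trivial,
    Finset.mul_sum, zero_mul, Finset.sum_const_zero, add_zero, Finset.univ_unique,
    Finset.sum_singleton]
  rw [add_comm]
  congr 1
  · exact Finset.sum_congr rfl fun j _ => by ring
  · ring

theorem sum_rateQ_dir (p : ℕ → ℝ) (i₁ i₂ p₁ p₂ : Fin l) :
    ∑ j, rateQ m n p t k j * (dir x y j (i₁, i₂) * dir x y j (p₁, p₂))
      = (1 - t) * (‖y i₂‖ * ‖y p₂‖ * inner ℝ (x i₁) (x p₁))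
        + t * p k * (‖x i₁‖ * ‖x p₁‖ * ‖y i₂‖ * ‖y p₂‖) := by
  simp only [Fintype.sum_sum_type, rateQ, dir, PiLp.inner_apply, RCLike.inner_apply, conj_trivial,
    Finset.mul_sum, zero_mul, Finset.sum_const_zero, zero_add, Finset.univ_unique,
    Finset.sum_singleton]
  rw [add_comm]
  congr 1
  · exact Finset.sum_congr rfl fun j _ => by ring
  · ring

end Final

end GaussianHierarchy

end

open GaussianHierarchy in
theorem mainTheorem2 {m n l : ℕ} (r : ℕ) (hr : 1 ≤ r)
    (x : Fin l → EuclideanSpace ℝ (Fin n)) (y : Fin l → EuclideanSpace ℝ (Fin m))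
    (p q mv : ℕ → ℝ) (β s t : ℝ)
    (hmv_zero : mv 0 = 1) (hmv_ne : ∀ k, 1 ≤ k → k ≤ r → mv k ≠ 0) (hmv_last : mv (r + 1) = 0)
    (hp_one : p 0 ≤ 1) (hp_anti : ∀ k, k ≤ r → p (k + 1) ≤ p k) (hp_last : p (r + 1) = 0)
    (hq_one : q 0 ≤ 1) (hq_anti : ∀ k, k ≤ r → q (k + 1) ≤ q k) (hq_last : q (r + 1) = 0)
    (hβ : 0 ≤ β) (ht : t ∈ Set.Icc (0 : ℝ) 1)
    (k₁ : ℕ) (hk₁ : 1 ≤ k₁) (hk₁r : k₁ ≤ r) :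
    HasDerivWithinAt
        (fun z : ℝ => FullLift.psi r x y (Function.update p k₁ z) q mv β s t)
        (Real.sign s * s * β / (2 * √(n : ℝ)) * FullLift.phiP r x y p q mv β s t k₁)
        (Set.Icc (p (k₁ + 1)) (p (k₁ - 1))) (p k₁) ∧
      HasDerivWithinAt
        (fun z : ℝ => FullLift.psi r x y p (Function.update q k₁ z) mv β s t)
        (Real.sign s * s * β / (2 * √(n : ℝ)) * FullLift.phiQ r x y p q mv β s t k₁)
        (Set.Icc (q (k₁ + 1)) (q (k₁ - 1))) (q k₁) := by
  obtain ⟨k, rfl⟩ : ∃ k, k₁ = k + 1 := ⟨k₁ - 1, by omega⟩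
  have e1 : k + 1 - 1 = k := rfl
  rcases isEmpty_or_nonempty (Fin l) with hl | hl
  · constructor
    · simp only [FullLift.phiP, gammaAvg_of_isEmpty, mul_zero, sub_zero]
      simp only [psi_eq_of_isEmpty _ q p q]
      exact hasDerivWithinAt_const _ _ _
    · simp only [FullLift.phiQ, gammaAvg_of_isEmpty, mul_zero, sub_zero]
      simp only [psi_eq_of_isEmpty p _ p q]
      exact hasDerivWithinAt_const _ _ _
  · have hpm := mem_Icc_of_anti hp_anti hk₁r
    have hqm := mem_Icc_of_anti hq_anti hk₁r
    rw [e1]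
    constructor
    · have main := hasDerivWithinAt_psi (x := x) (y := y) (mv := mv) (β := β) (s := s)
        (pz := fun z => Function.update p (k + 1) (clamp (p (k + 2)) (p k) z)) (qz := fun _ => q)
        (varianceShift_p (m := m) (n := n) ht hp_anti hp_last hq_anti hq_last hk₁r)
        hmv_zero hmv_ne hmv_last hk₁r (p (k + 1))
      rw [clamp_of_mem hpm, Function.update_eq_self] at main
      refine (main.congr (fun z hz => by rw [clamp_of_mem hz])
        (by rw [clamp_of_mem hpm])).congr_deriv ?_
      simp only [sum_rateP_dir]
      rw [gammaAvg_add_mul p q hk₁r, FullLift.phiP]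
      ring
    · have main := hasDerivWithinAt_psi (x := x) (y := y) (mv := mv) (β := β) (s := s)
        (pz := fun _ => p) (qz := fun z => Function.update q (k + 1) (clamp (q (k + 2)) (q k) z))
        (varianceShift_q (m := m) (n := n) ht hp_anti hp_last hq_anti hq_last hk₁r)
        hmv_zero hmv_ne hmv_last hk₁r (q (k + 1))
      rw [clamp_of_mem hqm, Function.update_eq_self] at main
      refine (main.congr (fun z hz => by rw [clamp_of_mem hz])
        (by rw [clamp_of_mem hqm])).congr_deriv ?_
      simp only [sum_rateQ_dir]
      rw [gammaAvg_add_mul p q hk₁r, FullLift.phiQ]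
      ring
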